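/- Let $X$ be a complex Banach space and let $T=(T(t))_{t\in\mathbb R}$ be a bounded $C_0$-group on $X$, that is, bounded linear operators with $T(0)=I$, $T(s+t)=T(s)T(t)$, $T(t)x\to x$ as $t\to0$ for every $x\in X$, and $\sup_t\|T(t)\|<\infty$. Let $A$ be its generator, $Ax=\lim_{t\to0}(T(t)x-x)/t$ on the domain of those $x$ for which the limit exists, and let $\sigma(A)$ be its spectrum. For $x\in X$ let $X_x$ be the closed linear span of $\{T(t)x:t\in\mathbb R\}$, let $T_x(t)$ be the restriction of $T(t)$ to $X_x$, and let $A_x$ be the generator of the bounded $C_0$-group $T_x$ on $X_x$. For $f\in L^1(\mathbb R)$ write $\hat f(\omega)=\int_{\mathbb R}e^{-i\omega t}f(t)\,dt$ and, for a bounded measurable $\phi:\mathbb R\to X$, $(f*\phi)(t)=\int_{\mathbb R}f(s)\phi(t-s)\,ds$. Put $$\mathcal L\phi(\lambda)=\int_0^\infty e^{-\lambda t}\phi(t)\,dt\quad(\operatorname{Re}\lambda>0),$$ $$\mathcal C\phi(\lambda)=\mathcal L\phi(\lambda)\ \ (\operatorname{Re}\lambda>0),\qquad \mathcal C\phi(\lambda)=-\int_0^\infty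 e^{\lambda t}\phi(-t)\,dt\ \ (\operatorname{Re}\lambda<0),$$ and let $\mathcal LT(\lambda),\mathcal CT(\lambda)\in L(X)$ be given by $\mathcal LT(\lambda)x=\mathcal L(T(\cdot)x)(\lambda)$ and $\mathcal CT(\lambda)x=\mathcal C(T(\cdot)x)(\lambda)$. A point $i\omega$ is regular for a function $\zeta$ that is holomorphic on $\Sigma=\{\operatorname{Re}\lambda>0\}$ or $\Sigma=\mathbb C\setminus i\mathbb R$ if, on some neighbourhood $V$ of $i\omega$, there is a holomorphic function that agrees with $\zeta$ on $V\cap\Sigma$; otherwise $i\omega$ is singular. Define, for $\Phi=T$ or $\Phi=T(\cdot)x$, - $sp^{\mathcal L}(\Phi)=\{\omega\in\mathbb R: i\omega \text{ is singular for }\mathcal L\Phi\}$ and $sp^{\mathcal C}(\Phi)=\{\omega\in\mathbb R: i\omega\text{ is singular for }\mathcal C\Phi\}$ (with values in $L(X)$ with the operator norm if $\Phi=T$, in $X$ if $\Phi=T(\cdot)x$); - $sp^B(T(\cdot)x)=\{\lambda\in\mathbb R: f*T(\cdot)x\neq0\text{ for all } f\in L^1(\mathbb R)\text{ with }\hat f(\lambda)=1\}$;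 - $sp^A(T(\cdot)x)=\{\lambda\in\mathbb R:$ for each $\varepsilon>0$ there is $f\in L^1(\mathbb R)$ with $\operatorname{supp}\hat f\subset(\lambda-\varepsilon,\lambda+\varepsilon)$ and $f*T(\cdot)x\ne0\}$; - $sp^B(T)=\{\lambda\in\mathbb R:$ there is $y\in X$ such that $f*T(\cdot)y\neq0$ for all $f\in L^1(\mathbb R)$ with $\hat f(\lambda)=1\}$; - $sp^A(T)=\{\lambda\in\mathbb R:$ for each $\varepsilon>0$ there are $y\in X$ and $f\in L^1(\mathbb R)$ with $\operatorname{supp}\hat f\subset(\lambda-\varepsilon,\lambda+\varepsilon)$ and $f*T(\cdot)y\ne0\}$. **Proposition 3.2.** For every $x\in X$, $$i\,sp^B(T(\cdot)x)=i\,sp^{\mathcal C}(T(\cdot)x)=i\,sp^{\mathcal L}(T(\cdot)x)=\sigma(A_x),$$ and $$i\,sp^A(T)=i\,sp^B(T)=i\,sp^{\mathcal C}(T)=i\,sp^{\mathcal L}(T)=\sigma(A).$$ Each of the sets in these two chains of equalities is closed. Moreover $sp^A(T)=\bigcup_{x\in X}sp^A(T(\cdot)x)$. -/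

import Mathlib

open MeasureTheory Filter Topology

noncomputable section

/-! ## Vector-valued functions on the line: transforms and spectra -/

section Functions

variable {E : Type*} [NormedAddCommGroup E] [NormedSpace ℂ E]

/-- The Fourier transform `f̂(ω) = ∫ e^{-iωt} f(t) dt` (without the factor `2π` in the exponent). -/
def fourierHat (f : ℝ → ℂ) (ω : ℝ) : ℂ :=
  ∫ t : ℝ, Complex.exp (-(Complex.I * ω * t)) * f t

/-- The convolution `(f * φ)(t) = ∫ f(s) φ(t - s) ds` of a scalar and a vector-valued function.
For integrable `f` and bounded measurable `φ` it is bounded and uniformly continuous, so that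
it vanishes almost everywhere if and only if it vanishes everywhere. -/
def convol (f : ℝ → ℂ) (φ : ℝ → E) (t : ℝ) : E :=
  ∫ s : ℝ, f s • φ (t - s)

/-- The Laplace transform `(ℒφ)(z) = ∫₀^∞ e^{-zt} φ(t) dt`, used for `Re z > 0`. -/
def laplaceTransform (φ : ℝ → E) (z : ℂ) : E :=
  ∫ t in Set.Ioi (0 : ℝ), Complex.exp (-(z * t)) • φ t

/-- The Carleman transform of `φ`: `∫₀^∞ e^{-zt} φ(t) dt` for `Re z > 0` and
`-∫₀^∞ e^{zt} φ(-t) dt` for `Re z < 0`. (Values on the imaginary axis are never used.) -/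
def carlemanTransform (φ : ℝ → E) (z : ℂ) : E :=
  if 0 < z.re then ∫ t in Set.Ioi (0 : ℝ), Complex.exp (-(z * t)) • φ t
  else -∫ t in Set.Ioi (0 : ℝ), Complex.exp (z * t) • φ (-t)

/-- The open right half plane. -/
def rightHalfPlane : Set ℂ := {z | 0 < z.re}

/-- The complement of the imaginary axis. -/
def offImaginaryAxis : Set ℂ := {z | z.re ≠ 0}

/-- `p` is a regular point of the function `ζ` given on `S`: some function that is holomorphic in a
neighbourhood of `p` agrees with `ζ` on the part of that neighbourhood inside `S`. -/
def IsRegularPoint (S : Set ℂ) (ζ : ℂ → E) (p : ℂ) : Prop :=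
  ∃ V : Set ℂ, IsOpen V ∧ p ∈ V ∧
    ∃ G : ℂ → E, DifferentiableOn ℂ G V ∧ ∀ z ∈ V ∩ S, G z = ζ z

/-- The Laplace (half-line) spectrum of a vector-valued function. -/
def laplaceSpectrum (φ : ℝ → E) : Set ℝ :=
  {ω | ¬ IsRegularPoint rightHalfPlane (laplaceTransform φ) (Complex.I * ω)}

/-- The Carleman spectrum of a vector-valued function. -/
def carlemanSpectrum (φ : ℝ → E) : Set ℝ :=
  {ω | ¬ IsRegularPoint offImaginaryAxis (carlemanTransform φ) (Complex.I * ω)}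

/-- The Beurling spectrum of a vector-valued function. -/
def beurlingSpectrum (φ : ℝ → E) : Set ℝ :=
  {ω | ∀ f : ℝ → ℂ, Integrable f → fourierHat f ω = 1 → convol f φ ≠ 0}

/-- The Arveson spectrum of a vector-valued function. -/
def arvesonSpectrum (φ : ℝ → E) : Set ℝ :=
  {ω | ∀ ε > 0, ∃ f : ℝ → ℂ, Integrable f ∧
    tsupport (fourierHat f) ⊆ Set.Ioo (ω - ε) (ω + ε) ∧ convol f φ ≠ 0}

end Functions

/-! ## Operator-valued functions on the line -/

section Operators

variable {X : Type*} [NormedAddCommGroup X] [NormedSpace ℂ X]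

open Classical in
/-- The bounded operator whose underlying map is `g` (and `0` if there is none). -/
def operatorOf (g : X → X) : X →L[ℂ] X :=
  if h : ∃ S : X →L[ℂ] X, ⇑S = g then h.choose else 0

theorem coe_operatorOf {g : X → X} (h : ∃ S : X →L[ℂ] X, ⇑S = g) : ⇑(operatorOf g) = g := by
  rw [operatorOf, dif_pos h]
  exact h.choose_spec

/-- The strong Laplace transform of an operator-valued function: `(ℒF)(z) x = ℒ(F(·)x)(z)`. -/
def laplaceTransformOp (F : ℝ → X →L[ℂ] X) (z : ℂ) : X →L[ℂ] X :=
  operatorOf fun x => laplaceTransform (fun t => F t x) z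

/-- The strong Carleman transform of an operator-valued function: `(𝒞F)(z) x = 𝒞(F(·)x)(z)`. -/
def carlemanTransformOp (F : ℝ → X →L[ℂ] X) (z : ℂ) : X →L[ℂ] X :=
  operatorOf fun x => carlemanTransform (fun t => F t x) z

/-- The Laplace spectrum of an operator-valued function; extensions are holomorphic for the
operator norm. -/
def laplaceSpectrumOp (F : ℝ → X →L[ℂ] X) : Set ℝ :=
  {ω | ¬ IsRegularPoint rightHalfPlane (laplaceTransformOp F) (Complex.I * ω)}

/-- The Carleman spectrum of an operator-valued function; extensions are holomorphic for the
operator norm. -/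
def carlemanSpectrumOp (F : ℝ → X →L[ℂ] X) : Set ℝ :=
  {ω | ¬ IsRegularPoint offImaginaryAxis (carlemanTransformOp F) (Complex.I * ω)}

/-- The Beurling spectrum of an operator-valued function. -/
def beurlingSpectrumOp (F : ℝ → X →L[ℂ] X) : Set ℝ :=
  {ω | ∃ y : X, ∀ f : ℝ → ℂ, Integrable f → fourierHat f ω = 1 →
    convol f (fun t => F t y) ≠ 0}

/-- The Arveson spectrum of an operator-valued function. -/
def arvesonSpectrumOp (F : ℝ → X →L[ℂ] X) : Set ℝ :=
  {ω | ∀ ε > 0, ∃ y : X, ∃ f : ℝ → ℂ, Integrable f ∧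
    tsupport (fourierHat f) ⊆ Set.Ioo (ω - ε) (ω + ε) ∧ convol f (fun t => F t y) ≠ 0}

/-- The spectrum of an unbounded operator `A`: all `z` for which `z - A` does not map the domain of
`A` bijectively onto the whole space with bounded inverse. -/
def unboundedSpectrum (A : X →ₗ.[ℂ] X) : Set ℂ :=
  {z | ¬ ∃ R : X →L[ℂ] X,
    (∀ x : X, ∃ u : A.domain, (u : X) = R x ∧ z • (u : X) - A u = x) ∧
    ∀ u : A.domain, R (z • (u : X) - A u) = u}

end Operators

/-! ## Bounded strongly continuous groups -/

/-- A bounded `C₀`-group of operators on `X`. -/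
structure BoundedC0Group (X : Type*) [NormedAddCommGroup X] [NormedSpace ℂ X] where
  /-- the operators of the group -/
  op : ℝ → X →L[ℂ] X
  op_zero : op 0 = ContinuousLinearMap.id ℂ X
  op_add : ∀ s t : ℝ, op (s + t) = (op s).comp (op t)
  tendsto_zero : ∀ x : X, Tendsto (fun t => op t x) (𝓝 0) (𝓝 x)
  bounded : ∃ M : ℝ, ∀ t : ℝ, ‖op t‖ ≤ M

namespace BoundedC0Group

variable {X : Type*} [NormedAddCommGroup X] [NormedSpace ℂ X] (T : BoundedC0Group X)

/-- The orbit `T(·)x`. -/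
def orbit (x : X) : ℝ → X := fun t => T.op t x

/-- `y = Ax`: the difference quotients `(T(t)x - x)/t` converge to `y` as `t → 0`. -/
def HasGeneratorValue (x y : X) : Prop :=
  Tendsto (fun t : ℝ => ((t⁻¹ : ℝ) : ℂ) • (T.op t x - x)) (𝓝[≠] 0) (𝓝 y)

variable {T} in
theorem HasGeneratorValue.add {x x' y y' : X} (h : T.HasGeneratorValue x y)
    (h' : T.HasGeneratorValue x' y') : T.HasGeneratorValue (x + x') (y + y') := by
  refine (Tendsto.add h h').congr fun t => ?_
  rw [map_add, ← smul_add]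
  congr 1
  abel

variable {T} in
theorem HasGeneratorValue.smul {x y : X} (c : ℂ) (h : T.HasGeneratorValue x y) :
    T.HasGeneratorValue (c • x) (c • y) := by
  refine (Tendsto.const_smul h c).congr fun t => ?_
  rw [map_smul, ← smul_sub, smul_comm]

theorem hasGeneratorValue_zero : T.HasGeneratorValue 0 0 := by
  simp [HasGeneratorValue]

/-- The infinitesimal generator `A` of the group, with its maximal domain. -/
def generator : X →ₗ.[ℂ] X where
  domain :=
    { carrier := {x | ∃ y, T.HasGeneratorValue x y}
      add_mem' := fun ⟨_, h⟩ ⟨_, h'⟩ => ⟨_, h.add h'⟩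
      zero_mem' := ⟨0, T.hasGeneratorValue_zero⟩
      smul_mem' := fun c _ ⟨_, h⟩ => ⟨_, h.smul c⟩ }
  toFun :=
    { toFun := fun x => x.2.choose
      map_add' := fun x y =>
        tendsto_nhds_unique (x + y).2.choose_spec (x.2.choose_spec.add y.2.choose_spec)
      map_smul' := fun c x =>
        tendsto_nhds_unique (c • x).2.choose_spec (x.2.choose_spec.smul c) }

theorem mem_graph_generator {x y : X} :
    (x, y) ∈ T.generator.graph ↔ T.HasGeneratorValue x y := by
  rw [LinearPMap.mem_graph_iff]
  constructor
  · rintro ⟨u, rfl, rfl⟩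
    exact u.2.choose_spec
  · intro h
    exact ⟨⟨x, y, h⟩, rfl, tendsto_nhds_unique (Exists.choose_spec (⟨y, h⟩ :
      ∃ y, T.HasGeneratorValue x y)) h⟩

/-- The closed linear span `X_x` of the orbit of `x`. -/
def orbitSpan (x : X) : Submodule ℂ X :=
  (Submodule.span ℂ (Set.range (T.orbit x))).topologicalClosure

theorem op_mem_orbitSpan (x : X) (t : ℝ) {z : X} (hz : z ∈ T.orbitSpan x) :
    T.op t z ∈ T.orbitSpan x := by
  have h : Set.MapsTo (T.op t) (Submodule.span ℂ (Set.range (T.orbit x)) : Set X)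
      (Submodule.span ℂ (Set.range (T.orbit x)) : Set X) := by
    intro w hw
    have h1 : Submodule.span ℂ (Set.range (T.orbit x)) ≤
        (Submodule.span ℂ (Set.range (T.orbit x))).comap (T.op t : X →ₗ[ℂ] X) := by
      rw [Submodule.span_le]
      rintro _ ⟨s, rfl⟩
      refine Submodule.subset_span ⟨t + s, ?_⟩
      simp [orbit, T.op_add]
    exact h1 hw
  exact h.closure (T.op t).continuous hz

/-- The restriction `T_x` of the group to the closed linear span `X_x` of the orbit of `x`. -/
def restrictOrbit (x : X) : BoundedC0Group (T.orbitSpan x) where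
  op t := ((T.op t).comp (T.orbitSpan x).subtypeL).codRestrict (T.orbitSpan x)
    fun z => T.op_mem_orbitSpan x t z.2
  op_zero := by
    ext z
    simp [T.op_zero]
  op_add s t := by
    ext z
    exact congrArg (fun S : X →L[ℂ] X => S z) (T.op_add s t)
  tendsto_zero z := by
    rw [tendsto_subtype_rng]
    exact T.tendsto_zero z
  bounded := by
    obtain ⟨M, hM⟩ := T.bounded
    refine ⟨M, fun t => ContinuousLinearMap.opNorm_le_bound _
      ((norm_nonneg _).trans (hM t)) fun z => ?_⟩
    exact (T.op t).le_of_opNorm_le (hM t) z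

theorem continuous_orbit (x : X) : Continuous (T.orbit x) := by
  rw [continuous_iff_continuousAt]
  intro s
  have h1 : Tendsto (fun t : ℝ => t - s) (𝓝 s) (𝓝 0) := by
    have : Continuous fun t : ℝ => t - s := by fun_prop
    simpa using this.tendsto s
  have h2 := ((T.op s).continuous.tendsto x).comp ((T.tendsto_zero x).comp h1)
  refine h2.congr fun t => ?_
  have : T.op t = (T.op s).comp (T.op (t - s)) := by
    rw [← T.op_add]
    congr 1
    ring
  simp [orbit, this]

theorem exists_laplaceOp {F : ℝ → X →L[ℂ] X} (hc : ∀ x, Continuous fun t => F t x)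
    {M : ℝ} (hM : ∀ t, ‖F t‖ ≤ M) {z : ℂ} (hz : 0 < z.re) :
    ∃ S : X →L[ℂ] X, ⇑S = fun x => laplaceTransform (fun t => F t x) z := by
  have hexp : IntegrableOn (fun t : ℝ => Real.exp (-z.re * t)) (Set.Ioi 0) :=
    exp_neg_integrableOn_Ioi 0 hz
  have hn : ∀ (x : X) (t : ℝ), ‖Complex.exp (-(z * t)) • F t x‖ ≤
      Real.exp (-z.re * t) * (M * ‖x‖) := by
    intro x t
    rw [norm_smul, Complex.norm_exp]
    have : (-(z * (t : ℂ))).re = -z.re * t := by simp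
    rw [this]
    gcongr
    exact (F t).le_of_opNorm_le (hM t) x
  have hint : ∀ x : X, IntegrableOn (fun t : ℝ => Complex.exp (-(z * t)) • F t x)
      (Set.Ioi 0) := by
    intro x
    refine Integrable.mono' (hexp.mul_const (M * ‖x‖)) ?_ (Eventually.of_forall (hn x))
    have : Continuous fun t : ℝ => Complex.exp (-(z * t)) • F t x := by
      have := hc x
      fun_prop
    exact this.aestronglyMeasurable
  refine ⟨LinearMap.mkContinuous
    { toFun := fun x => laplaceTransform (fun t => F t x) z
      map_add' := fun x y => ?_
      map_smul' := fun c x => ?_ }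
    ((∫ t in Set.Ioi (0 : ℝ), Real.exp (-z.re * t)) * M) fun x => ?_, rfl⟩
  · simp only [laplaceTransform, map_add, smul_add]
    exact integral_add (hint x) (hint y)
  · simp only [laplaceTransform, map_smul, RingHom.id_apply]
    rw [← integral_smul]
    refine integral_congr_ae (Eventually.of_forall fun t => ?_)
    exact smul_comm _ _ _
  · refine (norm_integral_le_of_norm_le (hexp.mul_const (M * ‖x‖))
      (Eventually.of_forall (hn x))).trans (le_of_eq ?_)
    rw [integral_mul_const, mul_assoc]

/-- The strong Laplace transform of a bounded group is given by the Laplace transforms of its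
orbits. -/
theorem laplaceTransformOp_apply {z : ℂ} (hz : z ∈ rightHalfPlane) (x : X) :
    laplaceTransformOp T.op z x = laplaceTransform (T.orbit x) z := by
  obtain ⟨M, hM⟩ := T.bounded
  exact congrFun (coe_operatorOf (exists_laplaceOp T.continuous_orbit hM hz)) x

/-- The strong Carleman transform of a bounded group is given by the Carleman transforms of its
orbits. -/
theorem carlemanTransformOp_apply {z : ℂ} (hz : z ∈ offImaginaryAxis) (x : X) :
    carlemanTransformOp T.op z x = carlemanTransform (T.orbit x) z := by
  obtain ⟨M, hM⟩ := T.bounded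
  refine congrFun (coe_operatorOf (g := fun x => carlemanTransform (fun t => T.op t x) z) ?_) x
  rcases lt_or_gt_of_ne (show z.re ≠ 0 from hz) with h | h
  · obtain ⟨S, hS⟩ := exists_laplaceOp (F := fun t => T.op (-t))
      (fun x => (T.continuous_orbit x).comp continuous_neg) (fun t => hM (-t))
      (z := -z) (by simpa using h)
    refine ⟨-S, funext fun x => ?_⟩
    have := congrFun hS x
    simp [this, laplaceTransform, carlemanTransform, not_lt.2 h.le]
  · obtain ⟨S, hS⟩ := exists_laplaceOp T.continuous_orbit hM h
    refine ⟨S, funext fun x => ?_⟩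
    have := congrFun hS x
    simp [this, laplaceTransform, carlemanTransform, h]

end BoundedC0Group

/-- `iS = {iω : ω ∈ S}` as a subset of the complex plane, for a set `S` of real numbers. -/
def imagSet (S : Set ℝ) : Set ℂ := (fun ω : ℝ => Complex.I * ω) '' S

end

noncomputable section

namespace BoundedC0Group

/-! ### Orbits and the generator. -/

section Generator

variable {X : Type*} [NormedAddCommGroup X] [NormedSpace ℂ X] (T : BoundedC0Group X)

/-! Off the imaginary axis the Carleman transform of the group is the resolvent of `A`
(`isResolventAt_carlemanTransformOp`), so `σ(A)` lies on the axis and everything can be tested at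
points `iω`. There each set of equalities follows from a cycle of inclusions.

For one orbit the cycle is `σ(A_x) ⊆ Beurling ⊆ Arveson ⊆ Laplace ⊆ Carleman ⊆ σ(A_x)`. The first
inclusion rests on approximate eigenvectors: if `iω ∈ σ(A_x)`, there are `y ∈ X_x` on which `T(t)`
is nearly multiplication by `e^{iωt}`, so the operator `∫ f(s) T(-s) ds` is nearly multiplication by
`f̂(ω) = 1` on them and cannot vanish on `X_x`; since it commutes with the group, it cannot vanish
at `x`. The second uses a smooth bump as Fourier transform. For the third, a holomorphic extension
of the Laplace transform satisfies the resolvent equation by the identity theorem, hence extends the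
Carleman transform on both sides of the axis. Damping by `e^{-ε|s|}` and Fourier inversion write `∫
f(s) T(-s)x ds` as a limit of integrals of `f̂` against the jump of the Carleman transform across
the axis, and this jump tends to zero on the support of `f̂`. The fourth is restriction to the right
half plane. The last holds because the resolvent of `A_x`, applied to `x`, is a holomorphic
extension.

For the whole group the cycle runs `σ(A) ⊆ Arveson ⊆ Laplace ⊆ Carleman ⊆ σ(A)`. Baire's theorem
(`arvesonSpectrumOp_eq_iUnion`) reduces the Arveson spectrum of the group to those of single orbits;
this gives the second inclusion and, with the result for orbits, the equality with the Beurling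
spectrum. Closedness is inherited from the spectrum of the generator. -/

theorem op_add_apply (s t : ℝ) (x : X) : T.op (s + t) x = T.op s (T.op t x) :=
  congrArg (fun S : X →L[ℂ] X => S x) (T.op_add s t)

theorem op_zero_apply (x : X) : T.op 0 x = x := by
  rw [T.op_zero]; rfl

/-- A positive bound for the norms of the operators of the group. -/
theorem exists_pos_bound : ∃ M : ℝ, 0 < M ∧ ∀ (t : ℝ) (x : X), ‖T.op t x‖ ≤ M * ‖x‖ := by
  obtain ⟨M, hM⟩ := T.bounded
  refine ⟨max M 1, by positivity, fun t x => ?_⟩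
  exact (T.op t).le_of_opNorm_le ((hM t).trans (le_max_left _ _)) x

/-- The reflected group `t ↦ T(-t)`. -/
def reflect : BoundedC0Group X where
  op t := T.op (-t)
  op_zero := by rw [neg_zero, T.op_zero]
  op_add s t := by rw [neg_add, T.op_add]
  tendsto_zero x := (T.tendsto_zero x).comp (by simpa using (continuous_neg (G := ℝ)).tendsto 0)
  bounded := T.bounded.imp fun _ hM t => hM (-t)

theorem reflect_reflect : T.reflect.reflect = T := by
  cases T
  simp [reflect]

theorem hasGeneratorValue_iff_hasDerivAt {x y : X} :
    T.HasGeneratorValue x y ↔ HasDerivAt (T.orbit x) y 0 := by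
  rw [hasDerivAt_iff_tendsto_slope_zero]
  simp only [HasGeneratorValue, orbit, zero_add, T.op_zero_apply]
  refine tendsto_congr fun t => ?_
  exact Complex.coe_smul _ _

variable {T}

/-- The group law `T(s)x = T(t) T(s - t)x` carries the derivative at `0` to any `t`. -/
theorem HasGeneratorValue.hasDerivAt_orbit {x y : X} (h : T.HasGeneratorValue x y) (t : ℝ) :
    HasDerivAt (T.orbit x) (T.op t y) t := by
  have h0 : HasDerivAt (T.orbit x) y (t - t) := by
    rw [sub_self]; exact T.hasGeneratorValue_iff_hasDerivAt.1 h
  have h1 : HasDerivAt (fun s => T.orbit x (s - t)) y t := h0.comp_sub_const t t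
  have h2 := ((T.op t).restrictScalars ℝ).hasFDerivAt.comp_hasDerivAt t h1
  refine h2.congr_of_eventuallyEq (Eventually.of_forall fun s => ?_)
  simp [orbit, ← T.op_add_apply]

theorem HasGeneratorValue.reflect {x y : X} (h : T.HasGeneratorValue x y) :
    T.reflect.HasGeneratorValue x (-y) := by
  rw [hasGeneratorValue_iff_hasDerivAt] at h ⊢
  have h0 : HasDerivAt (T.orbit x) y (-0) := by rwa [neg_zero]
  simpa using! h0.scomp (0 : ℝ) (hasDerivAt_neg (0 : ℝ))

/-- If `y = Ax`, then `T(t)x` differs from `e^{iωt}x` by at most `M |t| ‖Ax - iωx‖`. -/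
theorem HasGeneratorValue.norm_op_sub_le {x y : X} (h : T.HasGeneratorValue x y) {M : ℝ}
    (hM : ∀ (t : ℝ) (x : X), ‖T.op t x‖ ≤ M * ‖x‖) (ω t : ℝ) :
    ‖T.op t x - Complex.exp (Complex.I * ω * t) • x‖ ≤
      M * ‖y - (Complex.I * ω) • x‖ * |t| := by
  -- Undoing the rotation leaves a curve whose derivative is `e^{-iωs} T(s)(Ax - iωx)`, bounded
  -- uniformly in `s`; the mean value inequality then applies.
  have hd : ∀ s : ℝ, HasDerivAt (fun s : ℝ => Complex.exp (-(Complex.I * ω * s)) • T.op s x)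
      (Complex.exp (-(Complex.I * ω * s)) • T.op s (y - (Complex.I * ω) • x)) s := by
    intro s
    have h1 : HasDerivAt (fun s : ℝ => Complex.exp (-(Complex.I * ω * s)))
        (Complex.exp (-(Complex.I * ω * s)) * -(Complex.I * ω * 1)) s :=
      (((Complex.ofRealCLM.hasDerivAt (x := s)).const_mul (Complex.I * ω)).neg).cexp
    have h2 := h1.smul (h.hasDerivAt_orbit s)
    refine h2.congr_deriv ?_
    simp only [orbit, map_sub, map_smul, smul_sub, mul_one, mul_neg, neg_smul, mul_smul]
    abel
  have hn : ∀ s : ℝ, ‖Complex.exp (-(Complex.I * ω * s))‖ = 1 := by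
    intro s
    rw [Complex.norm_exp]
    simp
  have := (convex_univ (𝕜 := ℝ)).norm_image_sub_le_of_norm_hasDerivWithin_le
    (f := fun s : ℝ => Complex.exp (-(Complex.I * ω * s)) • T.op s x)
    (fun s _ => (hd s).hasDerivWithinAt)
    (C := M * ‖y - (Complex.I * ω) • x‖) (fun s _ => by
      rw [norm_smul, hn, one_mul]; exact hM s _) (Set.mem_univ 0) (Set.mem_univ t)
  simp only [T.op_zero_apply, Complex.ofReal_zero, mul_zero, neg_zero, Complex.exp_zero, one_smul,
    sub_zero, Real.norm_eq_abs] at this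
  refine le_trans (le_of_eq ?_) this
  have hn' : ‖Complex.exp (Complex.I * ω * t)‖ = 1 := by
    rw [Complex.norm_exp]
    simp
  rw [← one_mul ‖_ - x‖, ← hn', ← norm_smul, smul_sub, smul_smul, ← Complex.exp_add]
  simp

end Generator

/-! ### The resolvent of the generator. -/

section Resolvent

variable {X : Type*} [NormedAddCommGroup X] [NormedSpace ℂ X] {T : BoundedC0Group X}

variable (T) in
/-- `R` is the resolvent `(z - A)⁻¹` of the generator. -/
structure IsResolventAt (z : ℂ) (R : X →L[ℂ] X) : Prop where
  hasGeneratorValue : ∀ x, T.HasGeneratorValue (R x) (z • R x - x)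
  apply_sub : ∀ x y, T.HasGeneratorValue x y → R (z • x - y) = x

variable (T) in
theorem mem_unboundedSpectrum_iff {z : ℂ} :
    z ∈ unboundedSpectrum T.generator ↔ ¬ ∃ R : X →L[ℂ] X, T.IsResolventAt z R := by
  have hg : ∀ u : T.generator.domain, T.HasGeneratorValue u (T.generator u) := fun u =>
    T.mem_graph_generator.1 (T.generator.mem_graph u)
  have hu : ∀ x y (h : T.HasGeneratorValue x y), ∃ u : T.generator.domain, (u : X) = x ∧
      T.generator u = y := fun x y h => by
    have := T.mem_graph_generator.2 h
    rwa [LinearPMap.mem_graph_iff] at this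
  refine not_congr (exists_congr fun R => ⟨fun ⟨h1, h2⟩ => ⟨fun x => ?_, fun x y h => ?_⟩,
    fun h => ⟨fun x => ?_, fun u => h.apply_sub _ _ (hg u)⟩⟩)
  · obtain ⟨u, hu, hx⟩ := h1 x
    have := hg u
    rw [← hu]
    have e : z • (u : X) - x = T.generator u := by rw [← hx, sub_sub_cancel]
    rwa [e]
  · obtain ⟨u, rfl, rfl⟩ := hu x y h
    exact h2 u
  · obtain ⟨u, hux, huy⟩ := hu _ _ (h.hasGeneratorValue x)
    exact ⟨u, hux, by rw [huy, hux, sub_sub_cancel]⟩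

/-- The standard way below to recognise a vector as a resolvent value: check that it lies in the
domain and solves `(z - A)x = w`. -/
theorem IsResolventAt.eq_apply {z : ℂ} {R : X →L[ℂ] X} (h : T.IsResolventAt z R) {x w : X}
    (hx : T.HasGeneratorValue x (z • x - w)) : x = R w := by
  have := h.apply_sub x _ hx
  rwa [sub_sub_cancel, eq_comm] at this

theorem IsResolventAt.unique {z : ℂ} {R R' : X →L[ℂ] X} (h : T.IsResolventAt z R)
    (h' : T.IsResolventAt z R') : R = R' := by
  ext x
  exact h'.eq_apply (h.hasGeneratorValue x)

/-- The resolvent near a point of the resolvent set, by a Neumann series. -/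
theorem IsResolventAt.perturb {z₀ z : ℂ} {R : X →L[ℂ] X} (h : T.IsResolventAt z₀ R)
    (hz : IsUnit (1 + (z - z₀) • R)) :
    T.IsResolventAt z (R * Ring.inverse (1 + (z - z₀) • R)) := by
  -- On the domain, `z - A = (1 + (z - z₀)R)(z₀ - A)`, so the inverse has to be `R` composed with
  -- the inverse of the first factor.
  set U := Ring.inverse (1 + (z - z₀) • R) with hU
  have h1 : ∀ x, U x + (z - z₀) • R (U x) = x := fun x => by
    simpa using congrArg (fun S : X →L[ℂ] X => S x) (Ring.mul_inverse_cancel _ hz)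
  have h2 : ∀ x, U (x + (z - z₀) • R x) = x := fun x => by
    simpa [hU] using congrArg (fun S : X →L[ℂ] X => S x) (Ring.inverse_mul_cancel _ hz)
  refine ⟨fun x => ?_, fun x y hxy => ?_⟩
  · have := h.hasGeneratorValue (U x)
    have e : z₀ • R (U x) - U x = z • R (U x) - x := by
      nth_rewrite 4 [← h1 x]
      rw [sub_smul]
      abel
    rw [e] at this
    exact this
  · have hR := h.apply_sub x y hxy
    have e : z • x - y = (z₀ • x - y) + (z - z₀) • R (z₀ • x - y) := by
      rw [hR, sub_smul]
      abel
    change R (U (z • x - y)) = x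
    rw [e, h2, hR]

theorem isUnit_one_add_smul [CompleteSpace X] {R : X →L[ℂ] X} {c : ℂ} (h : ‖c‖ * ‖R‖ < 1) :
    IsUnit (1 + c • R) := by
  have : IsUnit (1 - (-(c • R))) := isUnit_one_sub_of_norm_lt_one (by rwa [norm_neg, norm_smul])
  rwa [sub_neg_eq_add] at this

/-- Near a point of the resolvent set the resolvent exists and is holomorphic. -/
theorem IsResolventAt.exists_differentiableOn [CompleteSpace X] {z₀ : ℂ} {R : X →L[ℂ] X}
    (h : T.IsResolventAt z₀ R) :
    ∃ V : Set ℂ, IsOpen V ∧ z₀ ∈ V ∧ ∃ G : ℂ → X →L[ℂ] X, DifferentiableOn ℂ G V ∧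
      ∀ z ∈ V, T.IsResolventAt z (G z) := by
  refine ⟨{z | ‖z - z₀‖ * ‖R‖ < 1}, ?_, by simp,
    fun z => R * Ring.inverse (1 + (z - z₀) • R), fun z hz => ?_, fun z hz =>
    h.perturb (isUnit_one_add_smul hz)⟩
  · exact isOpen_lt (by fun_prop) continuous_const
  · refine DifferentiableAt.differentiableWithinAt ?_
    have h1 : DifferentiableAt ℂ (fun z : ℂ => 1 + (z - z₀) • R) z := by fun_prop
    have h2 := (differentiableAt_inverse (𝕜 := ℂ) (isUnit_one_add_smul (R := R) hz)).comp z h1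
    exact (differentiableAt_const R).mul h2

variable (T) in
theorem isClosed_unboundedSpectrum [CompleteSpace X] :
    IsClosed (unboundedSpectrum T.generator) := by
  rw [← isOpen_compl_iff, isOpen_iff_mem_nhds]
  intro z₀ hz₀
  rw [Set.mem_compl_iff, mem_unboundedSpectrum_iff, not_not] at hz₀
  obtain ⟨R, hR⟩ := hz₀
  obtain ⟨V, hV, hzV, G, -, hG⟩ := hR.exists_differentiableOn
  refine mem_of_superset (hV.mem_nhds hzV) fun z hz => ?_
  rw [Set.mem_compl_iff, mem_unboundedSpectrum_iff, not_not]
  exact ⟨_, hG z hz⟩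

end Resolvent

/-! ### The Carleman transform as resolvent. -/

section Transforms

variable {X : Type*} [NormedAddCommGroup X] [NormedSpace ℂ X] (T : BoundedC0Group X)

theorem continuous_exp_smul_orbit (z : ℂ) (x : X) :
    Continuous fun t : ℝ => Complex.exp (-(z * t)) • T.orbit x t := by
  have := T.continuous_orbit x
  fun_prop

theorem integrableOn_exp_smul_orbit {z : ℂ} (hz : 0 < z.re) (x : X) (a : ℝ) :
    IntegrableOn (fun t : ℝ => Complex.exp (-(z * t)) • T.orbit x t) (Set.Ioi a) := by
  obtain ⟨M, -, hM⟩ := T.exists_pos_bound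
  refine Integrable.mono' ((exp_neg_integrableOn_Ioi a hz).mul_const (M * ‖x‖))
    (T.continuous_exp_smul_orbit z x).aestronglyMeasurable (Eventually.of_forall fun t => ?_)
  rw [norm_smul, Complex.norm_exp]
  have : (-(z * (t : ℂ))).re = -z.re * t := by simp
  rw [this]
  gcongr
  exact hM t x

theorem carlemanTransform_of_pos {z : ℂ} (hz : 0 < z.re) (x : X) :
    carlemanTransform (T.orbit x) z = laplaceTransform (T.orbit x) z := if_pos hz

theorem carlemanTransform_of_neg {z : ℂ} (hz : z.re < 0) (x : X) :
    carlemanTransform (T.orbit x) z = -laplaceTransform (T.reflect.orbit x) (-z) := by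
  rw [carlemanTransform, if_neg (not_lt.2 hz.le), laplaceTransform]
  simp [orbit, reflect]

variable [CompleteSpace X]

/-- Applying `T(h)` shifts the integrand, so `T(h)L = e^{zh}(L - ∫₀^h e^{-zt} T(t)x dt)`;
differentiating at `h = 0` gives `zL - x`. -/
theorem hasGeneratorValue_laplaceTransform {z : ℂ} (hz : 0 < z.re) (x : X) :
    T.HasGeneratorValue (laplaceTransform (T.orbit x) z)
      (z • laplaceTransform (T.orbit x) z - x) := by
  rw [hasGeneratorValue_iff_hasDerivAt]
  set φ : ℝ → X := fun t => Complex.exp (-(z * t)) • T.orbit x t with hφ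
  have hφc : Continuous φ := T.continuous_exp_smul_orbit z x
  have hφi : ∀ a, IntegrableOn φ (Set.Ioi a) := T.integrableOn_exp_smul_orbit hz x
  set L := laplaceTransform (T.orbit x) z with hL
  have key : ∀ h : ℝ, T.orbit L h = Complex.exp (z * h) • (L - ∫ t in (0 : ℝ)..h, φ t) := by
    intro h
    have h1 : T.op h L = ∫ t in Set.Ioi (0 : ℝ), T.op h (φ t) :=
      ((T.op h).integral_comp_comm (hφi 0)).symm
    have h2 : ∀ t : ℝ, T.op h (φ t) = Complex.exp (z * h) • φ (t + h) := by
      intro t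
      simp only [hφ, map_smul, orbit, smul_smul, ← Complex.exp_add]
      rw [← T.op_add_apply, add_comm h t]
      congr 2
      push_cast
      ring
    have h3 : ∫ t in Set.Ioi (0 : ℝ), φ (t + h) = ∫ t in Set.Ioi h, φ t := by
      have := (measurePreserving_add_right volume h).setIntegral_preimage_emb
        (measurableEmbedding_addRight h) φ (Set.Ioi h)
      rw [← this]
      simp
    rw [orbit, h1]
    simp_rw [h2]
    rw [integral_smul, h3, ← intervalIntegral.integral_Ioi_sub_Ioi' (hφi 0) (hφi h)]
    congr 1
    exact (sub_sub_cancel _ _).symm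
  have hd1 : HasDerivAt (fun h : ℝ => Complex.exp (z * h)) (Complex.exp (z * (0 : ℝ)) * (z * 1)) 0 :=
    ((Complex.ofRealCLM.hasDerivAt (x := (0 : ℝ))).const_mul z).cexp
  have hd2 : HasDerivAt (fun h : ℝ => L - ∫ t in (0 : ℝ)..h, φ t) (-φ 0) 0 :=
    (hφc.integral_hasStrictDerivAt 0 0).hasDerivAt.const_sub L
  have hd := (hd1.smul hd2).congr_of_eventuallyEq (Eventually.of_forall key)
  refine hd.congr_deriv ?_
  simp [hφ, orbit, T.op_zero_apply]
  abel

/-- The integrand `e^{-zt} T(t)(zx - Ax)` is minus the derivative of `e^{-zt} T(t)x`, which equals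
`x` at `0` and vanishes at infinity because the group is bounded. -/
theorem laplaceTransform_generator {z : ℂ} (hz : 0 < z.re) {x y : X}
    (h : T.HasGeneratorValue x y) : laplaceTransform (T.orbit (z • x - y)) z = x := by
  obtain ⟨M, -, hM⟩ := T.exists_pos_bound
  have hd : ∀ t : ℝ, HasDerivAt (fun t : ℝ => Complex.exp (-(z * t)) • T.orbit x t)
      (-(Complex.exp (-(z * t)) • T.orbit (z • x - y) t)) t := by
    intro t
    have h1 : HasDerivAt (fun t : ℝ => Complex.exp (-(z * t)))
        (Complex.exp (-(z * t)) * -(z * 1)) t :=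
      (((Complex.ofRealCLM.hasDerivAt (x := t)).const_mul z).neg).cexp
    refine (h1.smul (h.hasDerivAt_orbit t)).congr_deriv ?_
    simp only [orbit, map_sub, map_smul, smul_sub, mul_one, mul_neg, neg_smul, mul_smul]
    abel
  have ht : Tendsto (fun t : ℝ => Complex.exp (-(z * t)) • T.orbit x t) atTop (𝓝 0) := by
    have h0 : Tendsto (fun t : ℝ => Real.exp (-(z.re * t)) * (M * ‖x‖)) atTop (𝓝 (0 * (M * ‖x‖))) :=
      ((Real.tendsto_exp_neg_atTop_nhds_zero.comp (tendsto_id.const_mul_atTop hz))).mul_const _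
    rw [zero_mul] at h0
    refine squeeze_zero_norm (fun t => ?_) h0
    rw [norm_smul, Complex.norm_exp]
    have : (-(z * (t : ℂ))).re = -(z.re * t) := by simp
    rw [this]
    gcongr
    exact hM t x
  have := integral_Ioi_of_hasDerivAt_of_tendsto' (a := 0) (fun t _ => hd t)
    (T.integrableOn_exp_smul_orbit hz (z • x - y) 0).neg ht
  rw [integral_neg] at this
  simpa only [zero_sub, neg_inj, Complex.ofReal_zero, mul_zero, neg_zero, Complex.exp_zero, orbit,
    one_smul, T.op_zero_apply] using! this

/-- On the right this is the Laplace representation of the resolvent. On the left, the reflected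
group has generator `-A`, whose resolvent at `-z` is `-(z - A)⁻¹`; the minus sign in the Carleman
transform compensates. -/
theorem isResolventAt_carlemanTransformOp {z : ℂ} (hz : z ∈ offImaginaryAxis) :
    T.IsResolventAt z (carlemanTransformOp T.op z) := by
  rcases lt_or_gt_of_ne (show z.re ≠ 0 from hz) with h | h
  · have h' : 0 < (-z).re := by simpa using h
    refine ⟨fun x => ?_, fun x y hxy => ?_⟩
    · rw [T.carlemanTransformOp_apply hz, T.carlemanTransform_of_neg h]
      have := ((T.reflect.hasGeneratorValue_laplaceTransform h' x).reflect).smul (-1)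
      simp only [neg_smul, one_smul, neg_neg] at this
      rw [smul_neg, ← neg_smul]
      rw [T.reflect_reflect] at this
      convert! this using 1
      simp
    · rw [T.carlemanTransformOp_apply hz, T.carlemanTransform_of_neg h]
      have := T.reflect.laplaceTransform_generator h' hxy.reflect
      have e : T.reflect.orbit (z • x - y) = fun t => -T.reflect.orbit (-z • x - -y) t := by
        funext t
        have : z • x - y = -(-z • x - -y) := by
          rw [neg_smul]
          abel
        rw [this]
        exact map_neg _ _
      rw [e]
      simp only [laplaceTransform, smul_neg, integral_neg] at this ⊢
      rw [neg_neg]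
      exact this
  · refine ⟨fun x => ?_, fun x y hxy => ?_⟩
    · rw [T.carlemanTransformOp_apply hz, T.carlemanTransform_of_pos h]
      exact T.hasGeneratorValue_laplaceTransform h x
    · rw [T.carlemanTransformOp_apply hz, T.carlemanTransform_of_pos h]
      exact T.laplaceTransform_generator h hxy

end Transforms

end BoundedC0Group

/-! ### Fourier inversion and bump functions. -/

section FourierInversion

open FourierTransform

theorem fourierHat_eq_fourier (f : ℝ → ℂ) (η : ℝ) : fourierHat f η = 𝓕 f (η / (2 * Real.pi)) := by
  rw [Real.fourier_real_eq_integral_exp_smul, fourierHat]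
  congr 1
  ext t
  rw [smul_eq_mul]
  congr 2
  push_cast
  have : (Real.pi : ℂ) ≠ 0 := by exact_mod_cast Real.pi_ne_zero
  field_simp

theorem continuous_fourier_of_integrable {f : ℝ → ℂ} (hf : Integrable f) : Continuous (𝓕 f) :=
  VectorFourier.fourierIntegral_continuous Real.continuous_fourierChar
    (by exact continuous_inner) hf

theorem continuous_fourierInv_of_integrable {f : ℝ → ℂ} (hf : Integrable f) :
    Continuous (𝓕⁻ f) := by
  rw [Real.fourierInv_eq_fourier_comp_neg]
  exact continuous_fourier_of_integrable hf.comp_neg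

theorem continuous_fourierHat {f : ℝ → ℂ} (hf : Integrable f) : Continuous (fourierHat f) := by
  have h : fourierHat f = fun η => 𝓕 f (η / (2 * Real.pi)) := funext (fourierHat_eq_fourier f)
  rw [h]
  exact (continuous_fourier_of_integrable hf).comp (by fun_prop)

/-- Fourier inversion almost everywhere, for an integrable function with integrable Fourier
transform. -/
theorem fourierInv_fourier_ae_eq {f : ℝ → ℂ} (hf : Integrable f) (hf' : Integrable (𝓕 f)) :
    f =ᵐ[volume] 𝓕⁻ (𝓕 f) := by
  refine ae_eq_of_integral_contDiff_smul_eq hf.locallyIntegrable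
    (continuous_fourierInv_of_integrable hf').locallyIntegrable fun g hg hgc => ?_
  -- The test function is viewed as a Schwartz function, for which inversion is known; two
  -- applications of the multiplication formula move both transforms onto it.
  set ψ : SchwartzMap ℝ ℂ := (hgc.comp_left (g := ((↑) : ℝ → ℂ)) Complex.ofReal_zero).toSchwartzMap
    (Complex.ofRealCLM.contDiff.comp hg) with hψ
  have hψg : ∀ t, ψ t = g t := fun t => rfl
  have h1 : ∫ t, 𝓕 f t • 𝓕⁻ (ψ : ℝ → ℂ) t = ∫ t, f t • 𝓕 (𝓕⁻ (ψ : ℝ → ℂ)) t := by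
    have hi : Integrable (𝓕⁻ (ψ : ℝ → ℂ)) := by
      rw [← SchwartzMap.fourierInv_coe]
      exact (𝓕⁻ ψ).integrable (μ := volume)
    have := VectorFourier.integral_fourierIntegral_smul_eq_flip (L := innerₗ ℝ)
      Real.continuous_fourierChar continuous_inner hf hi
    rw [flip_innerₗ] at this
    exact this
  have h2 : ∫ t, 𝓕⁻ (𝓕 f) t • ψ t = ∫ t, 𝓕 f t • 𝓕⁻ (ψ : ℝ → ℂ) t := by
    have := VectorFourier.integral_fourierIntegral_smul_eq_flip (L := -innerₗ ℝ)
      Real.continuous_fourierChar continuous_inner.neg hf' (ψ.integrable (μ := volume))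
    have e : (-innerₗ ℝ : ℝ →ₗ[ℝ] ℝ →ₗ[ℝ] ℝ).flip = -innerₗ ℝ := by
      ext
      simp
    rw [e] at this
    exact this
  have h3 : 𝓕 (𝓕⁻ (ψ : ℝ → ℂ)) = ψ := by
    rw [← SchwartzMap.fourierInv_coe, ← SchwartzMap.fourier_coe,
      FourierTransform.fourier_fourierInv_eq]
  rw [h3] at h1
  have h4 := h2.trans h1
  simp only [hψg, smul_eq_mul] at h4
  simp only [Complex.real_smul]
  simp_rw [mul_comm ((g _ : ℝ) : ℂ)]
  exact h4.symm

/-- The inversion formula `f(s) = (2π)⁻¹ ∫ e^{iηs} f̂(η) dη` almost everywhere. -/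
theorem fourierHat_inversion_ae {f : ℝ → ℂ} (hf : Integrable f)
    (hf' : Integrable (fourierHat f)) :
    ∀ᵐ s : ℝ, f s = ((2 * Real.pi : ℝ) : ℂ)⁻¹ *
      ∫ η : ℝ, fourierHat f η * Complex.exp (Complex.I * η * s) := by
  have hpi : (0 : ℝ) < 2 * Real.pi := by positivity
  have hF : 𝓕 f = fun v => fourierHat f ((2 * Real.pi) * v) := by
    funext v
    rw [fourierHat_eq_fourier]
    field_simp
  have hF' : Integrable (𝓕 f) := by
    rw [hF]
    exact hf'.comp_mul_left' hpi.ne'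
  filter_upwards [fourierInv_fourier_ae_eq hf hF'] with s hs
  rw [hs, Real.fourierInv_eq', hF]
  have := Measure.integral_comp_mul_left
    (fun η : ℝ => fourierHat f η * Complex.exp (Complex.I * η * s)) (2 * Real.pi)
  rw [abs_of_pos (inv_pos.2 hpi), Complex.real_smul, Complex.ofReal_inv] at this
  rw [← this]
  congr 1
  ext v
  rw [smul_eq_mul, mul_comm]
  congr 2
  simp
  ring

/-- Integrable functions whose Fourier transform is a bump at a given point. -/
theorem exists_fourierHat_eq_one (ω : ℝ) {ε : ℝ} (hε : 0 < ε) :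
    ∃ f : ℝ → ℂ, Integrable f ∧ fourierHat f ω = 1 ∧
      tsupport (fourierHat f) ⊆ Set.Ioo (ω - ε) (ω + ε) := by
  have hpi : (0 : ℝ) < 2 * Real.pi := by positivity
  -- The factor `2π` converts between the two normalisations of the transform. The outer radius
  -- corresponds to `ε / 2`, so that the closed support fits in the open interval.
  let b : ContDiffBump (ω / (2 * Real.pi)) :=
    ⟨ε / 3 / (2 * Real.pi), ε / 2 / (2 * Real.pi), by positivity, by gcongr; norm_num⟩
  set ψ : SchwartzMap ℝ ℂ :=
    (b.hasCompactSupport.comp_left (g := ((↑) : ℝ → ℂ)) Complex.ofReal_zero).toSchwartzMap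
    (Complex.ofRealCLM.contDiff.comp b.contDiff) with hψ
  have hh : ∀ η, fourierHat (𝓕⁻ ψ : SchwartzMap ℝ ℂ) η = (b (η / (2 * Real.pi)) : ℂ) := by
    intro η
    rw [fourierHat_eq_fourier, ← SchwartzMap.fourier_coe, FourierTransform.fourier_fourierInv_eq]
    rfl
  refine ⟨(𝓕⁻ ψ : SchwartzMap ℝ ℂ), (𝓕⁻ ψ).integrable, ?_, ?_⟩
  · rw [hh, b.one_of_mem_closedBall (Metric.mem_closedBall_self b.rIn_pos.le), Complex.ofReal_one]
  · have hsub : tsupport (fourierHat (𝓕⁻ ψ : SchwartzMap ℝ ℂ)) ⊆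
        Metric.closedBall ω (ε / 2) := by
      refine closure_minimal (fun η hη => ?_) Metric.isClosed_closedBall
      by_contra hη'
      refine hη ?_
      rw [hh, b.zero_of_le_dist, Complex.ofReal_zero]
      rw [Metric.mem_closedBall, not_le] at hη'
      rw [Real.dist_eq, ← sub_div, abs_div, abs_of_pos hpi, ← Real.dist_eq]
      change ε / 2 / (2 * Real.pi) ≤ _
      gcongr
    refine hsub.trans fun η hη => ?_
    rw [Real.closedBall_eq_Icc] at hη
    constructor <;> linarith [hη.1, hη.2]

end FourierInversion

namespace BoundedC0Group

/-! ### Convolution with orbits as a bounded operator. -/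

section Convolution

variable {X : Type*} [NormedAddCommGroup X] [NormedSpace ℂ X] (T : BoundedC0Group X)

theorem integrable_smul_orbit {f : ℝ → ℂ} (hf : Integrable f) (x : X) (t : ℝ) :
    Integrable fun s : ℝ => f s • T.orbit x (t - s) := by
  obtain ⟨M, -, hM⟩ := T.exists_pos_bound
  have hc : Continuous fun s => T.orbit x (t - s) := (T.continuous_orbit x).comp (by fun_prop)
  refine (hf.norm.mul_const (M * ‖x‖)).mono' (hf.1.smul hc.aestronglyMeasurable)
    (Eventually.of_forall fun s => ?_)
  rw [norm_smul]
  gcongr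
  exact hM _ x

/-- The operator `∫ f(s) T(-s) ds` associated with an integrable function `f`. -/
def integralOp {f : ℝ → ℂ} (hf : Integrable f) : X →L[ℂ] X :=
  LinearMap.mkContinuousOfExistsBound
    { toFun := fun x => convol f (T.orbit x) 0
      map_add' := fun x y => by
        rw [convol, convol, convol, ← integral_add (T.integrable_smul_orbit hf x 0)
          (T.integrable_smul_orbit hf y 0)]
        simp [orbit]
      map_smul' := fun c x => by
        simp only [convol, RingHom.id_apply, ← integral_smul, orbit, map_smul]
        congr 1
        ext s
        exact smul_comm _ _ _ }
    (by
      obtain ⟨M, -, hM⟩ := T.exists_pos_bound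
      refine ⟨(∫ s, ‖f s‖) * M, fun x => ?_⟩
      refine (norm_integral_le_of_norm_le (hf.norm.mul_const (M * ‖x‖))
        (Eventually.of_forall fun s => ?_)).trans (le_of_eq ?_)
      · rw [norm_smul]
        gcongr
        exact hM _ x
      · rw [integral_mul_const, mul_assoc])

theorem integralOp_apply {f : ℝ → ℂ} (hf : Integrable f) (x : X) :
    T.integralOp hf x = ∫ s, f s • T.op (-s) x := by
  change convol f (T.orbit x) 0 = _
  simp [convol, orbit]

variable [CompleteSpace X]

/-- Pulling `T(t)` out of `∫ f(s) T(t - s)x ds` turns the vanishing of a function into the vanishing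
of one vector. -/
theorem convol_orbit {f : ℝ → ℂ} (hf : Integrable f) (x : X) (t : ℝ) :
    convol f (T.orbit x) t = T.op t (T.integralOp hf x) := by
  have h := (T.op t).integral_comp_comm (T.integrable_smul_orbit hf x 0)
  change _ = T.op t (∫ s, f s • T.orbit x (0 - s))
  rw [← h, convol]
  simp only [orbit, map_smul, ← T.op_add_apply, zero_sub, ← sub_eq_add_neg]

theorem integralOp_op {f : ℝ → ℂ} (hf : Integrable f) (x : X) (t : ℝ) :
    T.integralOp hf (T.op t x) = T.op t (T.integralOp hf x) := by
  rw [← T.convol_orbit hf, T.integralOp_apply hf, convol]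
  simp only [orbit, ← T.op_add_apply, sub_eq_add_neg, add_comm]

theorem convol_orbit_eq_zero_iff {f : ℝ → ℂ} (hf : Integrable f) (x : X) :
    convol f (T.orbit x) = 0 ↔ T.integralOp hf x = 0 := by
  refine ⟨fun h => ?_, fun h => funext fun t => ?_⟩
  · have := T.convol_orbit hf x 0
    rwa [h, T.op_zero_apply, Pi.zero_apply, eq_comm] at this
  · rw [T.convol_orbit hf, h, map_zero, Pi.zero_apply]

/-- If `f * T(·)x = 0`, then `f * T(·)y = 0` for all `y` in the closed linear span of the orbit. -/
theorem integralOp_eq_zero_of_mem_orbitSpan {f : ℝ → ℂ} (hf : Integrable f) {x y : X}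
    (hx : T.integralOp hf x = 0) (hy : y ∈ T.orbitSpan x) : T.integralOp hf y = 0 := by
  have h : T.orbitSpan x ≤ LinearMap.ker (T.integralOp hf : X →ₗ[ℂ] X) := by
    refine Submodule.topologicalClosure_minimal _ ?_ (T.integralOp hf).isClosed_ker
    rw [Submodule.span_le]
    rintro _ ⟨t, rfl⟩
    change T.integralOp hf (T.op t x) = 0
    rw [T.integralOp_op, hx, map_zero]
  exact h hy

end Convolution

/-! ### Approximate eigenvectors on the spectrum. -/

section ApproximateEigenvectors

variable {X : Type*} [NormedAddCommGroup X] [NormedSpace ℂ X] [CompleteSpace X]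
  (T : BoundedC0Group X)

theorem re_eq_zero_of_mem_unboundedSpectrum {z : ℂ} (hz : z ∈ unboundedSpectrum T.generator) :
    z.re = 0 := by
  by_contra h
  exact T.mem_unboundedSpectrum_iff.1 hz ⟨_, T.isResolventAt_carlemanTransformOp h⟩

/-- Points of the spectrum of the generator are approximate eigenvalues. -/
theorem exists_approx_eigenvector {ω : ℝ}
    (hω : Complex.I * ω ∈ unboundedSpectrum T.generator) {δ : ℝ} (hδ : 0 < δ) :
    ∃ y v : X, T.HasGeneratorValue y v ∧ y ≠ 0 ∧ ‖v - (Complex.I * ω) • y‖ ≤ δ * ‖y‖ := by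
  -- The resolvent `R` at `iω + ε` has norm at least `1/ε`, since otherwise a Neumann series would
  -- reach `iω`. Hence some `w` has `‖w‖ ≤ 2ε‖Rw‖`, and `y = Rw` satisfies `Ay - iωy = εy - w`, of
  -- norm at most `3ε‖y‖`.
  set ε : ℝ := δ / 3 with hε
  have hε0 : 0 < ε := by positivity
  set z : ℂ := Complex.I * ω + ε with hz
  have hR := T.isResolventAt_carlemanTransformOp (z := z)
    (show z.re ≠ 0 by simp [hz, hε0.ne'])
  set R := carlemanTransformOp T.op z
  have hnorm : 1 ≤ ε * ‖R‖ := by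
    by_contra! hlt
    refine T.mem_unboundedSpectrum_iff.1 hω ⟨_, hR.perturb (isUnit_one_add_smul ?_)⟩
    have : ‖Complex.I * ω - z‖ = ε := by
      rw [hz, sub_add_cancel_left, norm_neg, Complex.norm_real, Real.norm_of_nonneg hε0.le]
    rwa [this]
  have hlt : (2 * ε)⁻¹ < ‖R‖ := by
    rw [inv_lt_iff_one_lt_mul₀ (by positivity)]
    nlinarith
  obtain ⟨w, hw1, hw⟩ := R.exists_lt_apply_of_lt_opNorm hlt
  have hw' : ‖w‖ ≤ 2 * ε * ‖R w‖ := by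
    have : 1 < 2 * ε * ‖R w‖ := by
      rwa [inv_lt_iff_one_lt_mul₀' (by positivity)] at hw
    linarith
  refine ⟨R w, _, hR.hasGeneratorValue w, fun h => ?_, ?_⟩
  · rw [h, norm_zero] at hw
    exact absurd hw (not_lt.2 (by positivity))
  · have : z • R w - w - (Complex.I * ω) • R w = (ε : ℂ) • R w - w := by
      rw [hz, add_smul]
      abel
    rw [this]
    refine (norm_sub_le _ _).trans ?_
    rw [norm_smul, Complex.norm_real, Real.norm_of_nonneg hε0.le]
    have hδε : δ = ε + 2 * ε := by rw [hε]; ring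
    rw [hδε, add_mul]
    gcongr

/-- If `f̂(ω) = 1` for a point `iω` of the spectrum of the generator, then `f * T(·)y ≠ 0` for
some `y`. -/
theorem exists_integralOp_ne_zero {ω : ℝ} (hω : Complex.I * ω ∈ unboundedSpectrum T.generator)
    {f : ℝ → ℂ} (hf : Integrable f) (hfω : fourierHat f ω = 1) :
    ∃ y, T.integralOp hf y ≠ 0 := by
  by_contra! hzero
  obtain ⟨M, hM0, hM⟩ := T.exists_pos_bound
  -- The bound linear in `|s|` tends to zero with `n` but need not be integrable against `f`;
  -- capping it by the trivial bound `M + 1` provides a dominating function.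
  set F : ℕ → ℝ → ℝ := fun n s => ‖f s‖ * min (M + 1) (M * (1 / ((n : ℝ) + 1)) * |s|) with hF
  have hFm : ∀ n, AEStronglyMeasurable (F n) := fun n =>
    hf.1.norm.mul (Continuous.aestronglyMeasurable (by fun_prop))
  have hF0 : ∀ n s, 0 ≤ F n s := fun n s => by positivity
  have hFb : ∀ n s, ‖F n s‖ ≤ ‖f s‖ * (M + 1) := fun n s => by
    rw [Real.norm_of_nonneg (hF0 n s)]
    exact mul_le_mul_of_nonneg_left (min_le_left _ _) (norm_nonneg _)
  have hlim : Tendsto (fun n => ∫ s, F n s) atTop (𝓝 (∫ _s : ℝ, (0 : ℝ))) := by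
    refine tendsto_integral_of_dominated_convergence _ hFm (hf.norm.mul_const (M + 1))
      (fun n => Eventually.of_forall (hFb n)) (Eventually.of_forall fun s => ?_)
    have h1 : Tendsto (fun n : ℕ => min (M + 1) (M * (1 / ((n : ℝ) + 1)) * |s|)) atTop
        (𝓝 (min (M + 1) (M * 0 * |s|))) :=
      tendsto_const_nhds.min
        ((tendsto_one_div_add_atTop_nhds_zero_nat.const_mul M).mul_const |s|)
    have h2 := h1.const_mul ‖f s‖
    rwa [mul_zero, zero_mul, min_eq_right (by positivity), mul_zero] at h2
  have hge : ∀ n, 1 ≤ ∫ s, F n s := by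
    intro n
    obtain ⟨y, v, hyv, hy0, hv⟩ := T.exists_approx_eigenvector hω
      (δ := 1 / ((n : ℝ) + 1)) (by positivity)
    have hint : Integrable fun s : ℝ => (Complex.exp (-(Complex.I * ω * s)) * f s) • y := by
      refine Integrable.smul_const (hf.bdd_mul (c := 1)
        (Continuous.aestronglyMeasurable (by fun_prop)) (Eventually.of_forall fun s => ?_)) y
      rw [Complex.norm_exp]
      simp
    -- The first term integrates to `f̂(ω)y = y`, the second to zero by the assumption being
    -- refuted.
    have hy : y = ∫ s : ℝ, ((Complex.exp (-(Complex.I * ω * s)) * f s) • y - f s • T.op (-s) y) := by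
      have h0 := T.integrable_smul_orbit hf y 0
      simp only [zero_sub, orbit] at h0
      rw [integral_sub hint h0, integral_smul_const]
      change y = fourierHat f ω • y - ∫ s, f s • T.op (-s) y
      rw [hfω, ← T.integralOp_apply hf, hzero, one_smul, sub_zero]
    have hle : ‖y‖ ≤ ∫ s, F n s * ‖y‖ := by
      nth_rewrite 1 [hy]
      refine norm_integral_le_of_norm_le ?_ (Eventually.of_forall fun s => ?_)
      · exact ((hf.norm.mul_const (M + 1)).mono' (hFm n)
          (Eventually.of_forall (hFb n))).mul_const _
      · have e : (Complex.exp (-(Complex.I * ω * s)) * f s) • y - f s • T.op (-s) y =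
            -(f s • (T.op (-s) y - Complex.exp (Complex.I * ω * (-s : ℝ)) • y)) := by
          rw [smul_sub, smul_smul, mul_comm]
          simp
        rw [e, norm_neg, norm_smul]
        simp only [hF]
        rw [mul_assoc ‖f s‖]
        refine mul_le_mul_of_nonneg_left ?_ (norm_nonneg _)
        rw [min_mul_of_nonneg _ _ (norm_nonneg y)]
        refine le_min ?_ ?_
        · refine (norm_sub_le _ _).trans ?_
          rw [norm_smul, Complex.norm_exp, add_mul]
          gcongr
          · exact hM _ _
          · simp
        · refine (hyv.norm_op_sub_le hM ω (-s)).trans ?_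
          rw [abs_neg]
          calc M * ‖v - (Complex.I * ω) • y‖ * |s|
              ≤ M * (1 / ((n : ℝ) + 1) * ‖y‖) * |s| := by gcongr
            _ = _ := by ring
    rw [integral_mul_const] at hle
    have := norm_pos_iff.2 hy0
    exact le_of_mul_le_mul_right (by rwa [one_mul]) this
  rw [integral_zero] at hlim
  exact absurd (ge_of_tendsto' hlim hge) (by norm_num)

end ApproximateEigenvectors

/-! ### Restriction to the closed span of an orbit. -/

section RestrictOrbit

variable {X : Type*} [NormedAddCommGroup X] [NormedSpace ℂ X]
  (T : BoundedC0Group X)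

instance completeSpace_orbitSpan [CompleteSpace X] (x : X) : CompleteSpace (T.orbitSpan x) :=
  (Submodule.isClosed_topologicalClosure _).completeSpace_coe

theorem mem_orbitSpan_self (x : X) : x ∈ T.orbitSpan x :=
  Submodule.le_topologicalClosure _ (Submodule.subset_span ⟨0, T.op_zero_apply x⟩)

theorem HasGeneratorValue.of_restrictOrbit {T : BoundedC0Group X} {x : X} {y v : T.orbitSpan x}
    (h : (T.restrictOrbit x).HasGeneratorValue y v) : T.HasGeneratorValue (y : X) (v : X) :=
  tendsto_subtype_rng.1 h

variable [CompleteSpace X]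

theorem coe_integralOp_restrictOrbit {f : ℝ → ℂ} (hf : Integrable f) (x : X)
    (y : T.orbitSpan x) :
    ((T.restrictOrbit x).integralOp hf y : X) = T.integralOp hf (y : X) := by
  have h := (T.orbitSpan x).subtypeL.integral_comp_comm
    ((T.restrictOrbit x).integrable_smul_orbit hf y 0)
  exact h.symm

/-- A function annihilating the orbit of `x` annihilates all of `X_x`, which the approximate
eigenvectors of `A_x` forbid when `f̂(ω) = 1`. -/
theorem mem_beurlingSpectrum_of_mem_unboundedSpectrum {x : X} {ω : ℝ}
    (hω : Complex.I * ω ∈ unboundedSpectrum (T.restrictOrbit x).generator) :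
    ω ∈ beurlingSpectrum (T.orbit x) := by
  intro f hf hfω hzero
  rw [T.convol_orbit_eq_zero_iff hf] at hzero
  obtain ⟨y, hy⟩ := (T.restrictOrbit x).exists_integralOp_ne_zero hω hf hfω
  refine hy (Subtype.ext ?_)
  rw [T.coe_integralOp_restrictOrbit hf]
  exact T.integralOp_eq_zero_of_mem_orbitSpan hf hzero y.2

end RestrictOrbit

end BoundedC0Group

/-- Every point of the Beurling spectrum belongs to the Arveson spectrum. -/
theorem beurlingSpectrum_subset_arvesonSpectrum {E : Type*} [NormedAddCommGroup E]
    [NormedSpace ℂ E] (φ : ℝ → E) : beurlingSpectrum φ ⊆ arvesonSpectrum φ := by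
  intro ω hω ε hε
  obtain ⟨f, hf, hfω, hsupp⟩ := exists_fourierHat_eq_one ω hε
  exact ⟨f, hf, hsupp, hω f hf hfω⟩

/-! ### Damped orbits and the jump across the imaginary axis. -/

theorem integrable_exp_neg_mul_abs {ε : ℝ} (hε : 0 < ε) :
    Integrable fun s : ℝ => Real.exp (-ε * |s|) := by
  have h1 : IntegrableOn (fun s : ℝ => Real.exp (-ε * |s|)) (Set.Ioi 0) :=
    (exp_neg_integrableOn_Ioi 0 hε).congr_fun
      (fun s hs => by simp only [abs_of_pos (Set.mem_Ioi.1 hs)]) measurableSet_Ioi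
  have h2 : IntegrableOn (fun s : ℝ => Real.exp (-ε * |s|)) (Set.Iic 0) := by
    rw [integrableOn_Iic_iff_integrableOn_Iio]
    have := IntegrableOn.comp_neg_Iio (c := (0 : ℝ)) (f := fun s : ℝ => Real.exp (-ε * |s|))
      (μ := volume) (by rwa [neg_zero])
    simpa using this
  rw [← integrableOn_univ, ← Set.Iic_union_Ioi (a := (0 : ℝ))]
  exact h2.union h1

namespace BoundedC0Group

variable {X : Type*} [NormedAddCommGroup X] [NormedSpace ℂ X]
  (T : BoundedC0Group X)

theorem integrable_exp_neg_mul_abs_smul_op {ε : ℝ} (hε : 0 < ε) (η : ℝ) (x : X) :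
    Integrable fun s : ℝ =>
      (Complex.exp (Complex.I * η * s) * (Real.exp (-ε * |s|) : ℂ)) • T.op (-s) x := by
  obtain ⟨M, -, hM⟩ := T.exists_pos_bound
  have hc : Continuous fun s : ℝ => T.op (-s) x := (T.continuous_orbit x).comp continuous_neg
  refine ((integrable_exp_neg_mul_abs hε).mul_const (M * ‖x‖)).mono'
    (Continuous.aestronglyMeasurable (by fun_prop)) (Eventually.of_forall fun s => ?_)
  have e : ‖Complex.exp (Complex.I * η * s)‖ = 1 := by
    rw [Complex.norm_exp]
    simp
  rw [norm_smul, norm_mul, e, one_mul, Complex.norm_real, Real.norm_of_nonneg (Real.exp_pos _).le]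
  gcongr
  exact hM _ x

/-- Abel summation: the damping makes the Fourier transform of the orbit an honest integral, and
dominated convergence removes it again. -/
theorem tendsto_integral_exp_neg_mul_abs {f : ℝ → ℂ} (hf : Integrable f) (x : X) :
    Tendsto (fun ε : ℝ => ∫ s : ℝ, (f s * (Real.exp (-ε * |s|) : ℂ)) • T.op (-s) x) (𝓝[>] 0)
      (𝓝 (T.integralOp hf x)) := by
  obtain ⟨M, hM0, hM⟩ := T.exists_pos_bound
  rw [T.integralOp_apply]
  have hc : Continuous fun s : ℝ => T.op (-s) x := (T.continuous_orbit x).comp continuous_neg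
  refine tendsto_integral_filter_of_dominated_convergence (fun s => ‖f s‖ * (M * ‖x‖))
    (Eventually.of_forall fun ε => ?_) ?_ (hf.norm.mul_const _)
    (Eventually.of_forall fun s => ?_)
  · exact (hf.1.mul (Continuous.aestronglyMeasurable (by fun_prop))).smul hc.aestronglyMeasurable
  · filter_upwards [self_mem_nhdsWithin] with ε hε
    refine Eventually.of_forall fun s => ?_
    rw [norm_smul, norm_mul, Complex.norm_real, Real.norm_of_nonneg (Real.exp_pos _).le]
    have h1 : Real.exp (-ε * |s|) ≤ 1 := by
      rw [Real.exp_le_one_iff, neg_mul, neg_nonpos]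
      exact mul_nonneg (le_of_lt hε) (abs_nonneg s)
    calc ‖f s‖ * Real.exp (-ε * |s|) * ‖T.op (-s) x‖ ≤ ‖f s‖ * 1 * (M * ‖x‖) := by
          gcongr
          exact hM _ x
      _ = _ := by rw [mul_one]
  · have : Continuous fun ε : ℝ => (f s * (Real.exp (-ε * |s|) : ℂ)) • T.op (-s) x := by fun_prop
    have h := (this.tendsto 0).mono_left (nhdsWithin_le_nhds (s := Set.Ioi 0))
    simpa using h

/-- The Fourier transform of the damped orbit is a jump of the Carleman transform. -/
theorem integral_exp_neg_mul_abs_smul_op {ε : ℝ} (hε : 0 < ε) (η : ℝ) (x : X) :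
    ∫ s : ℝ, (Complex.exp (Complex.I * η * s) * (Real.exp (-ε * |s|) : ℂ)) • T.op (-s) x =
      carlemanTransform (T.orbit x) (ε + Complex.I * η) -
        carlemanTransform (T.orbit x) (-ε + Complex.I * η) := by
  have hi := T.integrable_exp_neg_mul_abs_smul_op hε η x
  rw [← intervalIntegral.integral_Iic_add_Ioi hi.integrableOn hi.integrableOn (b := 0),
    sub_eq_add_neg]
  congr 1
  · rw [carlemanTransform, if_pos (by simpa using hε), ← neg_zero, ← integral_comp_neg_Ioi]
    rw [neg_zero]
    refine setIntegral_congr_fun measurableSet_Ioi fun s hs => ?_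
    simp only [abs_neg, abs_of_pos (Set.mem_Ioi.1 hs), orbit, neg_neg, Complex.ofReal_exp,
      ← Complex.exp_add]
    congr 2
    push_cast
    ring
  · rw [carlemanTransform, if_neg (by simpa using hε.le), neg_neg]
    refine setIntegral_congr_fun measurableSet_Ioi fun s hs => ?_
    simp only [abs_of_pos (Set.mem_Ioi.1 hs), orbit, Complex.ofReal_exp, ← Complex.exp_add]
    congr 2
    push_cast
    ring

variable [CompleteSpace X]

/-- A holomorphic extension of `ℒ(T(·)x)` across a point of the imaginary axis also extends the
Carleman transform. -/
theorem exists_extension_carlemanTransform {x : X} {ω : ℝ}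
    (h : IsRegularPoint rightHalfPlane (laplaceTransform (T.orbit x)) (Complex.I * ω)) :
    ∃ r > 0, ∃ G : ℂ → X, ContinuousOn G (Metric.ball (Complex.I * ω) r) ∧
      ∀ z ∈ Metric.ball (Complex.I * ω) r, z.re ≠ 0 → G z = carlemanTransform (T.orbit x) z := by
  obtain ⟨V, hV, hωV, G, hG, hGL⟩ := h
  obtain ⟨r, hr, hrV⟩ := Metric.isOpen_iff.1 hV _ hωV
  refine ⟨r, hr, G, hG.continuousOn.mono hrV, ?_⟩
  set B := Metric.ball (Complex.I * ω) r with hB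
  -- A base point in the right half of the ball: `G` is the Laplace transform near it, and its
  -- resolvent `R` is available.
  set μ : ℂ := Complex.I * ω + (r / 2 : ℝ) with hμ
  have hμre : 0 < μ.re := by simp [hμ, hr]
  have hμB : μ ∈ B := by
    rw [hB, Metric.mem_ball, dist_eq_norm, hμ, add_sub_cancel_left, Complex.norm_real,
      Real.norm_of_nonneg (by positivity)]
    linarith
  have hR := T.isResolventAt_carlemanTransformOp (z := μ) hμre.ne'
  set R := carlemanTransformOp T.op μ
  have hGB : DifferentiableOn ℂ G B := hG.mono hrV
  have hBo : IsOpen B := Metric.isOpen_ball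
  -- This is `(z - A)G(z) = x` rewritten with the bounded operator `R`, so both sides are
  -- holomorphic without knowing that `G(z)` lies in the domain. It holds near `μ`, hence on the
  -- whole ball.
  have heq : Set.EqOn (fun z => G z) (fun z => R (x + (μ - z) • G z)) B := by
    refine AnalyticOnNhd.eqOn_of_preconnected_of_eventuallyEq (hGB.analyticOnNhd hBo)
      (DifferentiableOn.analyticOnNhd ?_ hBo)
      (convex_ball (Complex.I * (ω : ℂ)) r).isPreconnected hμB ?_
    · exact R.differentiable.comp_differentiableOn (by fun_prop)
    · have hopen : IsOpen {z : ℂ | 0 < z.re} := isOpen_lt continuous_const Complex.continuous_re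
      filter_upwards [hBo.mem_nhds hμB, hopen.mem_nhds hμre] with z hzB hz
      have hg := T.hasGeneratorValue_laplaceTransform hz x
      rw [← hGL z ⟨hrV hzB, hz⟩] at hg
      refine hR.eq_apply ?_
      convert! hg using 1
      rw [sub_smul]
      abel
  intro z hzB hz
  rw [← T.carlemanTransformOp_apply hz]
  refine (T.isResolventAt_carlemanTransformOp hz).eq_apply ?_
  -- Being in the range of `R`, the vector `G(z)` now lies in the domain and solves the resolvent
  -- equation at `z`, also to the left of the axis.
  have := hR.hasGeneratorValue (x + (μ - z) • G z)
  have hGz : G z = R (x + (μ - z) • G z) := heq hzB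
  rw [← hGz] at this
  convert! this using 1
  simp only [sub_smul]
  abel

/-- Insert the inversion formula for `f` and exchange the integrals, which the damping permits; the
inner integral in `s` is the jump of the Carleman transform. -/
theorem integral_exp_neg_mul_abs_eq {f : ℝ → ℂ} (hf : Integrable f)
    (hf' : Integrable (fourierHat f)) {ε : ℝ} (hε : 0 < ε) (x : X) :
    ∫ s : ℝ, (f s * (Real.exp (-ε * |s|) : ℂ)) • T.op (-s) x =
      ((2 * Real.pi : ℝ) : ℂ)⁻¹ • ∫ η : ℝ, fourierHat f η •
        (carlemanTransform (T.orbit x) (ε + Complex.I * η) -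
          carlemanTransform (T.orbit x) (-ε + Complex.I * η)) := by
  obtain ⟨M, hM0, hM⟩ := T.exists_pos_bound
  have hfc := continuous_fourierHat hf
  have hc : Continuous fun p : ℝ × ℝ => T.op (-p.1) x :=
    (T.continuous_orbit x).comp (by fun_prop)
  have hint : Integrable (Function.uncurry fun s η : ℝ => fourierHat f η •
      (Complex.exp (Complex.I * η * s) * (Real.exp (-ε * |s|) : ℂ)) • T.op (-s) x)
      (volume.prod volume) := by
    refine (((integrable_exp_neg_mul_abs hε).mul_const (M * ‖x‖)).mul_prod hf'.norm).mono'
      (Continuous.aestronglyMeasurable ?_) (Eventually.of_forall fun p => ?_)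
    · simp only [Function.uncurry_def]
      fun_prop
    · obtain ⟨s, η⟩ := p
      have e : ‖Complex.exp (Complex.I * η * s)‖ = 1 := by
        rw [Complex.norm_exp]
        simp
      simp only [Function.uncurry_apply_pair]
      rw [norm_smul, norm_smul, norm_mul, e, one_mul, Complex.norm_real,
        Real.norm_of_nonneg (Real.exp_pos _).le, mul_comm]
      gcongr
      exact hM _ x
  simp_rw [← T.integral_exp_neg_mul_abs_smul_op hε, ← integral_smul (fourierHat f _)]
  rw [← integral_integral_swap hint, ← integral_smul]
  refine integral_congr_ae ?_
  filter_upwards [fourierHat_inversion_ae hf hf'] with s hs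
  simp only [hs, smul_smul, ← mul_assoc]
  rw [integral_smul_const, smul_smul, integral_mul_const]
  simp only [mul_assoc]

/-- If `ℒ(T(·)x)` extends holomorphically across `iω`, then `f * T(·)x = 0` for all `f` whose
Fourier transform is supported near `ω`. -/
theorem arvesonSpectrum_subset_laplaceSpectrum (x : X) :
    arvesonSpectrum (T.orbit x) ⊆ laplaceSpectrum (T.orbit x) := by
  intro ω hω hreg
  obtain ⟨r, hr, G, hGc, hG⟩ := T.exists_extension_carlemanTransform hreg
  obtain ⟨f, hf, hsupp, hne⟩ := hω (r / 2) (by positivity)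
  refine hne ((T.convol_orbit_eq_zero_iff hf x).2 ?_)
  have hcs : HasCompactSupport (fourierHat f) :=
    isCompact_Icc.of_isClosed_subset (isClosed_tsupport _) (hsupp.trans Set.Ioo_subset_Icc_self)
  have hf' : Integrable (fourierHat f) :=
    (continuous_fourierHat hf).integrable_of_hasCompactSupport hcs
  refine tendsto_nhds_unique (T.tendsto_integral_exp_neg_mul_abs hf x) ?_
  rw [Metric.tendsto_nhds]
  intro δ hδ
  set N : ℝ := ∫ η, ‖fourierHat f η‖ with hN
  have hN0 : 0 ≤ N := integral_nonneg fun _ => norm_nonneg _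
  have hpi : (0 : ℝ) < 2 * Real.pi := by positivity
  -- For `η` in the support of `f̂` and `ε < r / 4`, both points `±ε + iη` are within `r / 2 + r /
  -- 4` of `iω`. On this compact set `G` is uniformly continuous.
  set K := Metric.closedBall (Complex.I * (ω : ℂ)) (3 * r / 4) with hK
  have hKB : K ⊆ Metric.ball (Complex.I * (ω : ℂ)) r :=
    Metric.closedBall_subset_ball (by linarith)
  have hu : UniformContinuousOn G K :=
    (isCompact_closedBall _ _).uniformContinuousOn_of_continuous (hGc.mono hKB)
  -- Chosen so that `N δ' / (2π) < δ`; the `+ 1` also covers `N = 0`.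
  set δ' : ℝ := 2 * Real.pi * δ / (N + 1) with hδ'
  have hδ'0 : 0 < δ' := by positivity
  obtain ⟨d, hd, hGd⟩ := Metric.uniformContinuousOn_iff.1 hu δ' hδ'0
  -- The bound `d / 2` appears because the two points `±ε + iη` are `2ε` apart.
  have hev : ∀ᶠ ε : ℝ in 𝓝[>] 0, ε < min (r / 4) (d / 2) :=
    nhdsWithin_le_nhds (eventually_lt_nhds (by positivity))
  filter_upwards [self_mem_nhdsWithin, hev] with ε hε hεlt
  have hε0 : 0 < ε := hε
  rw [T.integral_exp_neg_mul_abs_eq hf hf' hε0, dist_zero_right, norm_smul]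
  have hmem : ∀ η : ℝ, η ∈ tsupport (fourierHat f) → ∀ e : ℝ, |e| = ε →
      (e : ℂ) + Complex.I * η ∈ K := by
    intro η hη e he
    rw [hK, Metric.mem_closedBall, dist_eq_norm]
    have h1 : (e : ℂ) + Complex.I * η - Complex.I * ω = e + Complex.I * ((η - ω : ℝ) : ℂ) := by
      push_cast
      ring
    rw [h1]
    refine (norm_add_le _ _).trans ?_
    rw [norm_mul, Complex.norm_I, one_mul, Complex.norm_real, Complex.norm_real, Real.norm_eq_abs,
      Real.norm_eq_abs, he]
    have h2 : |η - ω| ≤ r / 2 := abs_le.2 ⟨by linarith [(hsupp hη).1], by linarith [(hsupp hη).2]⟩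
    linarith [hεlt.trans_le (min_le_left _ _)]
  have hbound : ‖∫ η : ℝ, fourierHat f η •
        (carlemanTransform (T.orbit x) (ε + Complex.I * η) -
          carlemanTransform (T.orbit x) (-ε + Complex.I * η))‖ ≤ N * δ' := by
    rw [hN, ← integral_mul_const]
    refine norm_integral_le_of_norm_le (hf'.norm.mul_const _) (Eventually.of_forall fun η => ?_)
    by_cases hη : η ∈ tsupport (fourierHat f)
    · have m1 := hmem η hη ε (abs_of_pos hε0)
      have m2 := hmem η hη (-ε) (by rw [abs_neg, abs_of_pos hε0])
      rw [Complex.ofReal_neg] at m2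
      rw [norm_smul, ← hG _ (hKB m1) (by simpa using hε0.ne'),
        ← hG _ (hKB m2) (by simpa using hε0.ne'), ← dist_eq_norm]
      gcongr
      refine (hGd _ m1 _ m2 ?_).le
      have : (ε : ℂ) + Complex.I * η - (-ε + Complex.I * η) = ((2 * ε : ℝ) : ℂ) := by
        push_cast
        ring
      rw [dist_eq_norm, this, Complex.norm_real, Real.norm_of_nonneg (by positivity)]
      linarith [hεlt.trans_le (min_le_right _ _)]
    · rw [image_eq_zero_of_notMem_tsupport hη, zero_smul, norm_zero, norm_zero, zero_mul]
  rw [norm_inv, Complex.norm_real, Real.norm_of_nonneg hpi.le, inv_mul_lt_iff₀ hpi]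
  refine hbound.trans_lt ?_
  rw [hδ', ← mul_div_assoc, div_lt_iff₀ (by positivity), mul_comm]
  exact mul_lt_mul_of_pos_left (by linarith) (by positivity)

end BoundedC0Group

/-! ### Comparison of the spectra. -/

theorem laplaceTransform_eq_carlemanTransform {E : Type*} [NormedAddCommGroup E] [NormedSpace ℂ E]
    (φ : ℝ → E) {z : ℂ} (hz : z ∈ rightHalfPlane) :
    laplaceTransform φ z = carlemanTransform φ z := (if_pos hz).symm

theorem IsRegularPoint.mono {E : Type*} [NormedAddCommGroup E] [NormedSpace ℂ E] {S S' : Set ℂ}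
    {ζ ζ' : ℂ → E} {p : ℂ} (h : IsRegularPoint S ζ p) (hS : S' ⊆ S)
    (hζ : ∀ z ∈ S', ζ' z = ζ z) : IsRegularPoint S' ζ' p := by
  obtain ⟨V, hV, hp, G, hG, hGζ⟩ := h
  exact ⟨V, hV, hp, G, hG, fun z hz => (hGζ z ⟨hz.1, hS hz.2⟩).trans (hζ z hz.2).symm⟩

theorem rightHalfPlane_subset_offImaginaryAxis : rightHalfPlane ⊆ offImaginaryAxis :=
  fun _ hz => ne_of_gt hz

/-- Every point of the Laplace spectrum belongs to the Carleman spectrum. -/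
theorem laplaceSpectrum_subset_carlemanSpectrum {E : Type*} [NormedAddCommGroup E]
    [NormedSpace ℂ E] (φ : ℝ → E) : laplaceSpectrum φ ⊆ carlemanSpectrum φ :=
  fun _ hω h => hω (h.mono rightHalfPlane_subset_offImaginaryAxis fun _ hz =>
    laplaceTransform_eq_carlemanTransform φ hz)

theorem imagSet_eq_of_forall_mem_iff {S : Set ℝ} {σ : Set ℂ} (hσ : ∀ z ∈ σ, z.re = 0)
    (h : ∀ ω : ℝ, ω ∈ S ↔ Complex.I * ω ∈ σ) : imagSet S = σ := by
  ext z
  constructor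
  · rintro ⟨ω, hω, rfl⟩
    exact (h ω).1 hω
  · intro hz
    have e : Complex.I * (z.im : ℂ) = z := by
      apply Complex.ext <;> simp [hσ z hz]
    exact ⟨z.im, (h _).2 (by rwa [e]), e⟩

theorem isClosed_of_forall_mem_iff {S : Set ℝ} {σ : Set ℂ} (hσ : IsClosed σ)
    (h : ∀ ω : ℝ, ω ∈ S ↔ Complex.I * ω ∈ σ) : IsClosed S := by
  have e : S = (fun ω : ℝ => Complex.I * (ω : ℂ)) ⁻¹' σ := Set.ext h
  rw [e]
  exact hσ.preimage (by fun_prop)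

namespace BoundedC0Group

variable {X : Type*} [NormedAddCommGroup X] [NormedSpace ℂ X]
  (T : BoundedC0Group X)

theorem laplaceSpectrumOp_subset_carlemanSpectrumOp :
    laplaceSpectrumOp T.op ⊆ carlemanSpectrumOp T.op := by
  refine fun _ hω h => hω (h.mono rightHalfPlane_subset_offImaginaryAxis fun z hz => ?_)
  ext x
  rw [T.laplaceTransformOp_apply hz,
    T.carlemanTransformOp_apply (rightHalfPlane_subset_offImaginaryAxis hz)]
  exact laplaceTransform_eq_carlemanTransform _ hz

theorem laplaceSpectrum_subset_laplaceSpectrumOp (x : X) :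
    laplaceSpectrum (T.orbit x) ⊆ laplaceSpectrumOp T.op := by
  rintro ω hω ⟨V, hV, hωV, G, hG, hGL⟩
  refine hω ⟨V, hV, hωV, fun z => G z x, hG.clm_apply (differentiableOn_const x), fun z hz => ?_⟩
  change G z x = _
  rw [hGL z hz, T.laplaceTransformOp_apply hz.2]

theorem beurlingSpectrumOp_eq_iUnion :
    beurlingSpectrumOp T.op = ⋃ x : X, beurlingSpectrum (T.orbit x) := by
  ext ω
  rw [Set.mem_iUnion]
  rfl

/-- The vectors `y` such that `f * T(·)y = 0` whenever `f̂` is supported in a given set. -/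
def annihilatedBy (U : Set ℝ) : Submodule ℂ X :=
  ⨅ (f : ℝ → ℂ) (hf : Integrable f) (_ : tsupport (fourierHat f) ⊆ U),
    LinearMap.ker (T.integralOp hf : X →ₗ[ℂ] X)

theorem isClosed_annihilatedBy (U : Set ℝ) : IsClosed (T.annihilatedBy U : Set X) := by
  simp only [annihilatedBy, Submodule.coe_iInf]
  exact isClosed_iInter fun f => isClosed_iInter fun hf => isClosed_iInter fun _ =>
    (T.integralOp hf).isClosed_ker

variable [CompleteSpace X]

/-- At a resolvent point of `A_x`, the vectors `(z - A_x)⁻¹x` depend holomorphically on `z`; seen in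
`X` they solve the resolvent equation for `A`, so off the axis they are values of the Carleman
transform. -/
theorem mem_unboundedSpectrum_of_mem_carlemanSpectrum {x : X} {ω : ℝ}
    (hω : ω ∈ carlemanSpectrum (T.orbit x)) :
    Complex.I * ω ∈ unboundedSpectrum (T.restrictOrbit x).generator := by
  rw [mem_unboundedSpectrum_iff]
  rintro ⟨R, hR⟩
  obtain ⟨V, hV, hωV, G, hG, hGR⟩ := hR.exists_differentiableOn
  set x' : T.orbitSpan x := ⟨x, T.mem_orbitSpan_self x⟩
  refine hω ⟨V, hV, hωV, fun z => (G z x' : X), ?_, fun z hz => ?_⟩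
  · exact (T.orbitSpan x).subtypeL.differentiable.comp_differentiableOn
      (hG.clm_apply (differentiableOn_const x'))
  · rw [← T.carlemanTransformOp_apply hz.2]
    exact (T.isResolventAt_carlemanTransformOp hz.2).eq_apply
      ((hGR z hz.1).hasGeneratorValue x').of_restrictOrbit

theorem mem_unboundedSpectrum_of_mem_carlemanSpectrumOp {ω : ℝ} (hω : ω ∈ carlemanSpectrumOp T.op) :
    Complex.I * ω ∈ unboundedSpectrum T.generator := by
  rw [mem_unboundedSpectrum_iff]
  rintro ⟨R, hR⟩
  obtain ⟨V, hV, hωV, G, hG, hGR⟩ := hR.exists_differentiableOn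
  exact hω ⟨V, hV, hωV, G, hG, fun z hz =>
    (hGR z hz.1).unique (T.isResolventAt_carlemanTransformOp hz.2)⟩

/-- The local spectra of an orbit at a point `ω` all express that `iω` belongs to the spectrum of
the generator of the group restricted to the closed linear span of the orbit. -/
theorem mem_spectra_orbit_iff (x : X) (ω : ℝ) :
    (ω ∈ arvesonSpectrum (T.orbit x) ↔
      Complex.I * ω ∈ unboundedSpectrum (T.restrictOrbit x).generator) ∧
    (ω ∈ beurlingSpectrum (T.orbit x) ↔
      Complex.I * ω ∈ unboundedSpectrum (T.restrictOrbit x).generator) ∧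
    (ω ∈ carlemanSpectrum (T.orbit x) ↔
      Complex.I * ω ∈ unboundedSpectrum (T.restrictOrbit x).generator) ∧
    (ω ∈ laplaceSpectrum (T.orbit x) ↔
      Complex.I * ω ∈ unboundedSpectrum (T.restrictOrbit x).generator) := by
  have h1 : Complex.I * ω ∈ unboundedSpectrum (T.restrictOrbit x).generator →
      ω ∈ beurlingSpectrum (T.orbit x) := T.mem_beurlingSpectrum_of_mem_unboundedSpectrum
  have h2 := @beurlingSpectrum_subset_arvesonSpectrum _ _ _ (T.orbit x) ω
  have h3 : ω ∈ arvesonSpectrum (T.orbit x) → ω ∈ laplaceSpectrum (T.orbit x) := fun h =>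
    T.arvesonSpectrum_subset_laplaceSpectrum x h
  have h4 := @laplaceSpectrum_subset_carlemanSpectrum _ _ _ (T.orbit x) ω
  have h5 : ω ∈ carlemanSpectrum (T.orbit x) → Complex.I * ω ∈
      unboundedSpectrum (T.restrictOrbit x).generator := T.mem_unboundedSpectrum_of_mem_carlemanSpectrum
  exact ⟨⟨h5 ∘ h4 ∘ h3, h2 ∘ h1⟩, ⟨h5 ∘ h4 ∘ h3 ∘ h2, h1⟩, ⟨h5, h4 ∘ h3 ∘ h2 ∘ h1⟩,
    ⟨h5 ∘ h4, h3 ∘ h2 ∘ h1⟩⟩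

theorem mem_annihilatedBy {U : Set ℝ} {y : X} :
    y ∈ T.annihilatedBy U ↔ ∀ f : ℝ → ℂ, Integrable f → tsupport (fourierHat f) ⊆ U →
      convol f (T.orbit y) = 0 := by
  simp only [annihilatedBy, Submodule.mem_iInf]
  exact forall_congr' fun f => forall_congr' fun hf => forall_congr' fun _ =>
    (T.convol_orbit_eq_zero_iff hf y).symm

/-- Baire's theorem: if `ω` is in no local spectrum, each vector is annihilated by all `f` with `f̂`
supported in the interval of radius `1/(n+1)` about `ω`, for some `n`. These closed subspaces cover
`X`, so one has interior and is all of `X`; a single interval then works for every vector. -/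
theorem arvesonSpectrumOp_eq_iUnion :
    arvesonSpectrumOp T.op = ⋃ x : X, arvesonSpectrum (T.orbit x) := by
  refine Set.Subset.antisymm (fun ω hω => ?_) (Set.iUnion_subset fun x ω hω ε hε =>
    ⟨x, hω ε hε⟩)
  by_contra hcon
  simp only [Set.mem_iUnion, not_exists] at hcon
  set U : ℕ → Set ℝ := fun n => Set.Ioo (ω - 1 / ((n : ℝ) + 1)) (ω + 1 / ((n : ℝ) + 1)) with hU
  have hcover : ⋃ n, (T.annihilatedBy (U n) : Set X) = Set.univ := by
    refine Set.eq_univ_of_forall fun x => Set.mem_iUnion.2 ?_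
    have hx := hcon x
    simp only [arvesonSpectrum, Set.mem_ofPred_eq, not_forall] at hx
    obtain ⟨ε, hε, hx⟩ := hx
    obtain ⟨n, hn⟩ := exists_nat_one_div_lt hε
    refine ⟨n, T.mem_annihilatedBy.2 fun f hf hsupp => ?_⟩
    by_contra hne
    exact hx ⟨f, hf, hsupp.trans (Set.Ioo_subset_Ioo (by linarith) (by linarith)), hne⟩
  obtain ⟨n, hn⟩ := nonempty_interior_of_iUnion_of_closed
    (fun n => T.isClosed_annihilatedBy (U n)) hcover
  have htop := Submodule.eq_top_of_nonempty_interior' _ hn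
  obtain ⟨y, f, hf, hsupp, hne⟩ := hω (1 / ((n : ℝ) + 1)) (by positivity)
  exact hne (T.mem_annihilatedBy.1 (htop ▸ Submodule.mem_top : y ∈ T.annihilatedBy (U n)) f hf hsupp)

/-- The vector obtained depends on `f`, which the Arveson spectrum of the group allows; the Beurling
spectrum demands one vector for all `f`, so the cycle for the group starts here. -/
theorem mem_arvesonSpectrumOp_of_mem_unboundedSpectrum {ω : ℝ}
    (hω : Complex.I * ω ∈ unboundedSpectrum T.generator) : ω ∈ arvesonSpectrumOp T.op := by
  intro ε hε
  obtain ⟨f, hf, hfω, hsupp⟩ := exists_fourierHat_eq_one ω hε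
  obtain ⟨y, hy⟩ := T.exists_integralOp_ne_zero hω hf hfω
  exact ⟨y, f, hf, hsupp, fun h => hy ((T.convol_orbit_eq_zero_iff hf y).1 h)⟩

/-- The spectra of the group at a point `ω` all express that `iω` belongs to the spectrum of the
generator. -/
theorem mem_spectra_op_iff (ω : ℝ) :
    (ω ∈ arvesonSpectrumOp T.op ↔ Complex.I * ω ∈ unboundedSpectrum T.generator) ∧
    (ω ∈ beurlingSpectrumOp T.op ↔ Complex.I * ω ∈ unboundedSpectrum T.generator) ∧
    (ω ∈ carlemanSpectrumOp T.op ↔ Complex.I * ω ∈ unboundedSpectrum T.generator) ∧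
    (ω ∈ laplaceSpectrumOp T.op ↔ Complex.I * ω ∈ unboundedSpectrum T.generator) := by
  have h1 : Complex.I * ω ∈ unboundedSpectrum T.generator → ω ∈ arvesonSpectrumOp T.op :=
    T.mem_arvesonSpectrumOp_of_mem_unboundedSpectrum
  -- Both spectra are unions over orbits, and for each orbit they coincide.
  have h2 : ω ∈ arvesonSpectrumOp T.op ↔ ω ∈ beurlingSpectrumOp T.op := by
    rw [T.arvesonSpectrumOp_eq_iUnion, T.beurlingSpectrumOp_eq_iUnion, Set.mem_iUnion,
      Set.mem_iUnion]
    exact exists_congr fun x =>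
      (T.mem_spectra_orbit_iff x ω).1.trans (T.mem_spectra_orbit_iff x ω).2.1.symm
  have h3 : ω ∈ arvesonSpectrumOp T.op → ω ∈ laplaceSpectrumOp T.op := by
    rw [T.arvesonSpectrumOp_eq_iUnion, Set.mem_iUnion]
    rintro ⟨x, hx⟩
    exact T.laplaceSpectrum_subset_laplaceSpectrumOp x
      (T.arvesonSpectrum_subset_laplaceSpectrum x hx)
  have h4 : ω ∈ laplaceSpectrumOp T.op → ω ∈ carlemanSpectrumOp T.op := fun h =>
    T.laplaceSpectrumOp_subset_carlemanSpectrumOp h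
  have h5 : ω ∈ carlemanSpectrumOp T.op → Complex.I * ω ∈ unboundedSpectrum T.generator :=
    T.mem_unboundedSpectrum_of_mem_carlemanSpectrumOp
  exact ⟨⟨h5 ∘ h4 ∘ h3, h1⟩, h2.symm.trans ⟨h5 ∘ h4 ∘ h3, h1⟩, ⟨h5, h4 ∘ h3 ∘ h1⟩,
    ⟨h5 ∘ h4, h3 ∘ h1⟩⟩

end BoundedC0Group

end

theorem proposition3p2 {X : Type*} [NormedAddCommGroup X] [NormedSpace ℂ X] [CompleteSpace X]
    (T : BoundedC0Group X) :
    (∀ x : X,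
      (imagSet (beurlingSpectrum (T.orbit x)) = imagSet (carlemanSpectrum (T.orbit x)) ∧
        imagSet (carlemanSpectrum (T.orbit x)) = imagSet (laplaceSpectrum (T.orbit x)) ∧
        imagSet (laplaceSpectrum (T.orbit x)) =
          unboundedSpectrum (T.restrictOrbit x).generator) ∧
      IsClosed (beurlingSpectrum (T.orbit x)) ∧ IsClosed (carlemanSpectrum (T.orbit x)) ∧
      IsClosed (laplaceSpectrum (T.orbit x)) ∧
      IsClosed (unboundedSpectrum (T.restrictOrbit x).generator)) ∧
    (imagSet (arvesonSpectrumOp T.op) = imagSet (beurlingSpectrumOp T.op) ∧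
      imagSet (beurlingSpectrumOp T.op) = imagSet (carlemanSpectrumOp T.op) ∧
      imagSet (carlemanSpectrumOp T.op) = imagSet (laplaceSpectrumOp T.op) ∧
      imagSet (laplaceSpectrumOp T.op) = unboundedSpectrum T.generator) ∧
    (IsClosed (arvesonSpectrumOp T.op) ∧ IsClosed (beurlingSpectrumOp T.op) ∧
      IsClosed (carlemanSpectrumOp T.op) ∧ IsClosed (laplaceSpectrumOp T.op) ∧
      IsClosed (unboundedSpectrum T.generator)) ∧
    arvesonSpectrumOp T.op = ⋃ x : X, arvesonSpectrum (T.orbit x) := by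
  refine ⟨fun x => ?_, ?_, ?_, T.arvesonSpectrumOp_eq_iUnion⟩
  · have hσ := (T.restrictOrbit x).isClosed_unboundedSpectrum
    have hre : ∀ z ∈ unboundedSpectrum (T.restrictOrbit x).generator, z.re = 0 :=
      fun z hz => (T.restrictOrbit x).re_eq_zero_of_mem_unboundedSpectrum hz
    have h := T.mem_spectra_orbit_iff x
    have hB := imagSet_eq_of_forall_mem_iff hre fun ω => (h ω).2.1
    have hC := imagSet_eq_of_forall_mem_iff hre fun ω => (h ω).2.2.1
    have hL := imagSet_eq_of_forall_mem_iff hre fun ω => (h ω).2.2.2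
    exact ⟨⟨hB.trans hC.symm, hC.trans hL.symm, hL⟩,
      isClosed_of_forall_mem_iff hσ fun ω => (h ω).2.1,
      isClosed_of_forall_mem_iff hσ fun ω => (h ω).2.2.1,
      isClosed_of_forall_mem_iff hσ fun ω => (h ω).2.2.2, hσ⟩
  · have hre : ∀ z ∈ unboundedSpectrum T.generator, z.re = 0 :=
      fun z hz => T.re_eq_zero_of_mem_unboundedSpectrum hz
    have h := T.mem_spectra_op_iff
    have hA := imagSet_eq_of_forall_mem_iff hre fun ω => (h ω).1
    have hB := imagSet_eq_of_forall_mem_iff hre fun ω => (h ω).2.1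
    have hC := imagSet_eq_of_forall_mem_iff hre fun ω => (h ω).2.2.1
    have hL := imagSet_eq_of_forall_mem_iff hre fun ω => (h ω).2.2.2
    exact ⟨hA.trans hB.symm, hB.trans hC.symm, hC.trans hL.symm, hL⟩
  · have hσ := T.isClosed_unboundedSpectrum
    have h := T.mem_spectra_op_iff
    exact ⟨isClosed_of_forall_mem_iff hσ fun ω => (h ω).1,
      isClosed_of_forall_mem_iff hσ fun ω => (h ω).2.1,
      isClosed_of_forall_mem_iff hσ fun ω => (h ω).2.2.1,
      isClosed_of_forall_mem_iff hσ fun ω => (h ω).2.2.2, hσ⟩
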